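/- Let $p\in\mathbb N$, let $n=n_1+\dots+n_p$, $k=k_1+\dots+k_p$, $m=m_1+\dots+m_p$, and let $\gamma>0$. Consider the real generalized plant $$\dot x=Ax+B_0d+Bu,\qquad e=C_0x+D_0d+Eu,\qquad y=Cx+Fd,$$ where $A\in\mathbb R^{n\times n}$, $B\in\mathbb R^{n\times m}$, $C\in\mathbb R^{k\times n}$ are lower block-triangular ($p\times p$ blocks) for the given partitions of $n,m,k$. A \emph{structured controller} is a system $u=D^Ky+C^K\xi$, $\dot\xi=A^K\xi+B^Ky$, together with a partition $n^K=n^K_1+\dots+n^K_p$ of its state dimension, such that $A^K,B^K,C^K,D^K$ are all lower block-triangular. The closed loop is $$\begin{pmatrix}\mathcal A&\mathcal B\\\mathcal C&\mathcal D\end{pmatrix}=\begin{pmatrix}A&0&B_0\\0&0&0\\C_0&0&D_0\end{pmatrix}+\begin{pmatrix}B&0\\0&I\\E&0\end{pmatrix}\begin{pmatrix}D^K&C^K\\B^K&A^K\end{pmatrix}\begin{pmatrix}C&0&F\\0&I&0\end{pmatrix},$$ and the bounded-real LMI for a symmetric $\mathcal X$ is $$\mathcal X\succ0,\qquad\begin{pmatrix}\mathcal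 A^T\mathcal X+\mathcal X\mathcal A&\mathcal X\mathcal B&\mathcal C^T\\\mathcal B^T\mathcal X&-\gamma I&\mathcal D^T\\\mathcal C&\mathcal D&-\gamma I\end{pmatrix}\prec0.\tag{lmi1}$$ A controller solves the $H_\infty$-synthesis problem if $\mathcal A$ is Hurwitz and $\|\mathcal C(sI-\mathcal A)^{-1}\mathcal B+\mathcal D\|_\infty<\gamma$. For any partition into $p$ blocks let $R_j$ be the $j$-th block column of the identity matrix, $L_j$ the block columns $j,\dots,p$ and $\Lambda_j$ the block columns $1,\dots,j-1$. For $j=1,\dots,p+1$ let $\Gamma_j$ be any basis matrix (full column rank, with range equal to the subspace) of $$\ker\begin{pmatrix}\Lambda_j^TC&\Lambda_j^TF&0\\L_j^TB^T&0&L_j^TE^T\end{pmatrix}.$$ With variables $\hat X_j=\hat X_j^T$, $\hat Y_j=\hat Y_j^T$, $\hat Z_j$ of dimensions $n_1+\dots+n_{j-1}$, $n_j+\dots+n_p$ and $(n_j+\dots+n_p)\times(n_1+\dots+n_{j-1})$ put $$X_j=\begin{pmatrix}\hat X_j&\hat Z_j^T\\0&I\end{pmatrix},\qquad Y_j=\begin{pmatrix}I&0\\-\hat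 Z_j&\hat Y_j\end{pmatrix},\qquad j=1,\dots,p+1,$$ so that $X_1=I$ and $Y_{p+1}=I$. Consider the LMIs $$\Gamma_j^T\begin{pmatrix}(X_j^TAY_j)^T+X_j^TAY_j&X_j^TB_0&Y_j^TC_0^T\\B_0^TX_j&-\gamma I&D_0^T\\C_0Y_j&D_0&-\gamma I\end{pmatrix}\Gamma_j\prec0,\quad j=1,\dots,p+1,\tag{st1}$$ $$\begin{pmatrix}Y_j^TX_j&X_j^TY_{j+1}\\Y_{j+1}^TX_j&Y_{j+1}^TX_{j+1}\end{pmatrix}\succ0,\quad j=1,\dots,p.\tag{st2}$$ (a) There is a structured controller for which (lmi1) holds with some symmetric $\mathcal X$ if and only if (st1)–(st2) are feasible. (b) If (st1)–(st2) are feasible, there is a structured controller of McMillan degree at most $np$ that solves the $H_\infty$-synthesis problem. (c) Such a controller is obtained from any solution of (st1)–(st2) as follows. Put $X=(X_2\ \cdots\ X_{p+1})$, $Y=(Y_1\ \cdots\ Y_p)$, $U=I_{np}$, and let $V=(V_1\ \cdots\ V_p)\in\mathbb R^{np\times np}$ be the matrix whose block $(i,j)$ is $Y_{i+1}^TX_j-X_{i+1}^TY_j$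 for $i\ge j$ and $0$ for $i<j$; partition $np=n+\dots+n$. For $\nu=1,\dots,p$ let $K_\nu$ be any basis matrix of $$\ker\begin{pmatrix}\Lambda_\nu^TCY&\Lambda_\nu^TC&\Lambda_\nu^TF&0\\\Lambda_\nu^TV&0&0&0\end{pmatrix},$$ and with $\mathrm{He}(M)=M^T+M$ consider, in unstructured matrices $S_1,\dots,S_p$ of compatible dimensions, the inequalities $$\mathrm{He}\Big[K_\nu^T\Big(\begin{pmatrix}AY&A&B_0&0\\X^TAY&X^TA&X^TB_0&0\\0&0&-\frac\gamma2I&0\\C_0Y&C_0&D_0&-\frac\gamma2I\end{pmatrix}+\sum_{j=\nu}^p\begin{pmatrix}BL_j&0\\X^TBL_j&U^TL_j\\0&0\\EL_j&0\end{pmatrix}S_j\begin{pmatrix}R_j^TCY&R_j^TC&R_j^TF&0\\R_j^TV&0&0&0\end{pmatrix}\Big)K_\nu\Big]\prec0.\tag{coco}$$ They can be solved recursively for $\nu=p,p-1,\dots,1$: whatever $S_p,\dots,S_{\nu+1}$ have been chosen so as to satisfy (coco) for the indices $p,\dots,\nu+1$, there is an $S_\nu$ that satisfies (coco) for the index $\nu$.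 For arbitrary $S_1,\dots,S_p$ satisfying all the inequalities (coco), the matrices given by $$\begin{pmatrix}D^K&C^K\\B^K&A^K\end{pmatrix}=\sum_{j=1}^p\begin{pmatrix}L_j&0\\0&L_j\end{pmatrix}S_j\begin{pmatrix}R_j^T&0\\0&R_j^T\end{pmatrix}$$ (with $A^K$ partitioned according to $np=n+\dots+n$) define a structured controller of McMillan degree at most $np$ that satisfies (lmi1) for some symmetric $\mathcal X$ and solves the $H_\infty$-synthesis problem. -/

import Mathlib

open scoped Matrix

noncomputable section

namespace NestedHinf

/-! ### Block partitions

A vector partitioned into `p` blocks is indexed by `Σ i : Fin p, κ i`. Blocks are numbered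
`0, …, p - 1`; the objects with `p + 1` indices are numbered `0, …, p`. -/

/-- Indices of vectors partitioned into `p` blocks, the `i`-th one indexed by `κ i`. -/
abbrev Blk {p : ℕ} (κ : Fin p → Type) : Type := Σ i : Fin p, κ i

/-- Indices of vectors partitioned into `p` blocks of dimensions `n 0, …, n (p - 1)`. -/
abbrev Idx {p : ℕ} (n : Fin p → ℕ) : Type := Blk fun i => Fin (n i)

/-- The indices in the blocks strictly before the `j`-th one. -/
abbrev Lo {p : ℕ} (κ : Fin p → Type) (j : Fin (p + 1)) : Type :=
  {a : Blk κ // a.1.val < j.val}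

/-- The indices in the blocks from the `j`-th one on. -/
abbrev Hi {p : ℕ} (κ : Fin p → Type) (j : Fin (p + 1)) : Type :=
  {a : Blk κ // ¬ a.1.val < j.val}

/-- All blocks strictly above the block diagonal vanish. -/
def LowerTri {p : ℕ} {κ κ' : Fin p → Type} (M : Matrix (Blk κ) (Blk κ') ℝ) : Prop :=
  ∀ a b, a.1 < b.1 → M a b = 0

/-- The block columns `j, …, p - 1` of the identity matrix (the matrix `L_j`). -/
def selL {p : ℕ} (κ : Fin p → Type) [∀ i, DecidableEq (κ i)] (j : Fin (p + 1)) :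
    Matrix (Blk κ) (Hi κ j) ℝ :=
  (1 : Matrix (Blk κ) (Blk κ) ℝ).submatrix id Subtype.val

/-- The block columns `0, …, j - 1` of the identity matrix (the complement of `L_j`). -/
def selLc {p : ℕ} (κ : Fin p → Type) [∀ i, DecidableEq (κ i)] (j : Fin (p + 1)) :
    Matrix (Blk κ) (Lo κ j) ℝ :=
  (1 : Matrix (Blk κ) (Blk κ) ℝ).submatrix id Subtype.val

/-- The `j`-th block column of the identity matrix (the matrix `R_j`). -/
def selR {p : ℕ} (κ : Fin p → Type) [∀ i, DecidableEq (κ i)] (j : Fin p) :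
    Matrix (Blk κ) (κ j) ℝ :=
  (1 : Matrix (Blk κ) (Blk κ) ℝ).submatrix id (Sigma.mk j)

/-! ### Matrix notions -/

/-- A block matrix with three block rows and three block columns. -/
def block3 {a b c a' b' c' : Type}
    (M11 : Matrix a a' ℝ) (M12 : Matrix a b' ℝ) (M13 : Matrix a c' ℝ)
    (M21 : Matrix b a' ℝ) (M22 : Matrix b b' ℝ) (M23 : Matrix b c' ℝ)
    (M31 : Matrix c a' ℝ) (M32 : Matrix c b' ℝ) (M33 : Matrix c c' ℝ) :
    Matrix (a ⊕ (b ⊕ c)) (a' ⊕ (b' ⊕ c')) ℝ :=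
  Matrix.fromBlocks M11 (Matrix.fromCols M12 M13) (Matrix.fromRows M21 M31)
    (Matrix.fromBlocks M22 M23 M32 M33)

/-- `He(M) = Mᵀ + M`. -/
def He {a : Type} (M : Matrix a a ℝ) : Matrix a a ℝ := Mᵀ + M

/-- Symmetric and negative definite. -/
def NegDef {a : Type} (M : Matrix a a ℝ) : Prop := (-M).PosDef

/-- The kernel of a matrix. -/
def ker {a b : Type} [Fintype b] (M : Matrix a b ℝ) : Submodule ℝ (b → ℝ) :=
  LinearMap.ker M.mulVecLin

/-- `M` has full column rank and its range is `S`. -/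
def IsBasisMatrix {a b : Type} [Fintype b] (M : Matrix a b ℝ) (S : Submodule ℝ (a → ℝ)) : Prop :=
  LinearIndependent ℝ M.col ∧ LinearMap.range M.mulVecLin = S

/-! ### State-space systems -/

/-- The transfer matrix `C (sI - A)⁻¹ B + D` as a matrix of rational functions in `s`. -/
def transferFun {x i o : Type} [Fintype x] [DecidableEq x]
    (A : Matrix x x ℝ) (B : Matrix x i ℝ) (C : Matrix o x ℝ) (D : Matrix o i ℝ) :
    Matrix o i (RatFunc ℝ) :=
  C.map (algebraMap ℝ (RatFunc ℝ)) *
      (Matrix.scalar x RatFunc.X - A.map (algebraMap ℝ (RatFunc ℝ)))⁻¹ *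
      B.map (algebraMap ℝ (RatFunc ℝ)) +
    D.map (algebraMap ℝ (RatFunc ℝ))

/-- The McMillan degree of the transfer matrix realized by `(A, B, C, D)`: the least state
dimension among all its realizations. -/
def mcMillanDegree {x i o : Type} [Fintype x] [DecidableEq x]
    (A : Matrix x x ℝ) (B : Matrix x i ℝ) (C : Matrix o x ℝ) (D : Matrix o i ℝ) : ℕ :=
  sInf {r : ℕ | ∃ (A' : Matrix (Fin r) (Fin r) ℝ) (B' : Matrix (Fin r) i ℝ)
    (C' : Matrix o (Fin r) ℝ) (D' : Matrix o i ℝ),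
    transferFun A' B' C' D' = transferFun A B C D}

/-- All complex eigenvalues lie in the open left half-plane. -/
def Hurwitz {x : Type} [Fintype x] [DecidableEq x] (A : Matrix x x ℝ) : Prop :=
  ∀ μ ∈ spectrum ℂ (A.map (algebraMap ℝ ℂ)), μ.re < 0

/-- The value of the transfer matrix `C (sI - A)⁻¹ B + D` at `s ∈ ℂ`. -/
def transferAt {x i o : Type} [Fintype x] [DecidableEq x]
    (A : Matrix x x ℝ) (B : Matrix x i ℝ) (C : Matrix o x ℝ) (D : Matrix o i ℝ) (s : ℂ) :
    Matrix o i ℂ :=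
  C.map (algebraMap ℝ ℂ) * (Matrix.scalar x s - A.map (algebraMap ℝ ℂ))⁻¹ *
      B.map (algebraMap ℝ ℂ) +
    D.map (algebraMap ℝ ℂ)

/-- The largest singular value, i.e. the operator norm for the Euclidean norms. -/
def specNorm {i o : Type} [Fintype i] [DecidableEq i] [Fintype o] (M : Matrix o i ℂ) : ℝ :=
  ‖LinearMap.toContinuousLinearMap (Matrix.toEuclideanLin M)‖

/-- The `H∞`-norm of a stable transfer matrix: the supremum of its largest singular value over the
open right half-plane. -/
def hinfNorm {x i o : Type} [Fintype x] [DecidableEq x] [Fintype i] [DecidableEq i] [Fintype o]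
    (A : Matrix x x ℝ) (B : Matrix x i ℝ) (C : Matrix o x ℝ) (D : Matrix o i ℝ) : ENNReal :=
  ⨆ (s : ℂ) (_ : 0 < s.re), ENNReal.ofReal (specNorm (transferAt A B C D s))

/-- A generalized plant `ẋ = A x + B₀ d + B u`, `e = C₀ x + D₀ d + E u`, `y = C x + F d`, where
`x`, `y`, `u` are partitioned into `p` blocks of dimensions `n i`, `k i`, `m i`, and `d`, `e` have
dimensions `nd`, `ne`. -/
structure Plant {p : ℕ} (n k m : Fin p → ℕ) (nd ne : ℕ) where
  A : Matrix (Idx n) (Idx n) ℝ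
  B₀ : Matrix (Idx n) (Fin nd) ℝ
  B : Matrix (Idx n) (Idx m) ℝ
  C₀ : Matrix (Fin ne) (Idx n) ℝ
  D₀ : Matrix (Fin ne) (Fin nd) ℝ
  E : Matrix (Fin ne) (Idx m) ℝ
  C : Matrix (Idx k) (Idx n) ℝ
  F : Matrix (Idx k) (Fin nd) ℝ

/-- `A`, `B`, `C` are lower block-triangular. -/
def Plant.IsStructured {p : ℕ} {n k m : Fin p → ℕ} {nd ne : ℕ} (P : Plant n k m nd ne) : Prop :=
  LowerTri P.A ∧ LowerTri P.B ∧ LowerTri P.C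

/-- A controller `ξ̇ = A ξ + B y`, `u = C ξ + D y` whose state is partitioned into `p` blocks, the
`i`-th one indexed by `κ i`. -/
structure Controller {p : ℕ} (κ : Fin p → Type) (k m : Fin p → ℕ) where
  A : Matrix (Blk κ) (Blk κ) ℝ
  B : Matrix (Blk κ) (Idx k) ℝ
  C : Matrix (Idx m) (Blk κ) ℝ
  D : Matrix (Idx m) (Idx k) ℝ

namespace Controller

variable {p : ℕ} {κ : Fin p → Type} {k m : Fin p → ℕ}

/-- All four controller matrices are lower block-triangular. -/
def IsStructured (K : Controller κ k m) : Prop :=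
  LowerTri K.A ∧ LowerTri K.B ∧ LowerTri K.C ∧ LowerTri K.D

/-- The McMillan degree of the transfer matrix of the controller. -/
def degree [∀ i, Fintype (κ i)] [∀ i, DecidableEq (κ i)] (K : Controller κ k m) : ℕ :=
  mcMillanDegree K.A K.B K.C K.D

/-- The matrix `[D C; B A]`. -/
def mat (K : Controller κ k m) : Matrix (Idx m ⊕ Blk κ) (Idx k ⊕ Blk κ) ℝ :=
  Matrix.fromBlocks K.D K.C K.B K.A

/-- The controller with a given matrix `[D C; B A]`. -/
def ofMat (M : Matrix (Idx m ⊕ Blk κ) (Idx k ⊕ Blk κ) ℝ) : Controller κ k m where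
  D := M.toBlocks₁₁
  C := M.toBlocks₁₂
  B := M.toBlocks₂₁
  A := M.toBlocks₂₂

end Controller

/-! ### The closed loop -/

section ClosedLoop

variable {p : ℕ} {n k m : Fin p → ℕ} {nd ne : ℕ} {κ : Fin p → Type}
  [∀ i, Fintype (κ i)] [∀ i, DecidableEq (κ i)]

/-- The matrix `[B 0; 0 I]`. -/
def extB (P : Plant n k m nd ne) (κ : Fin p → Type) [∀ i, DecidableEq (κ i)] :
    Matrix (Idx n ⊕ Blk κ) (Idx m ⊕ Blk κ) ℝ :=
  Matrix.fromBlocks P.B 0 0 1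

/-- The matrix `[C 0; 0 I]`. -/
def extC (P : Plant n k m nd ne) (κ : Fin p → Type) [∀ i, DecidableEq (κ i)] :
    Matrix (Idx k ⊕ Blk κ) (Idx n ⊕ Blk κ) ℝ :=
  Matrix.fromBlocks P.C 0 0 1

/-- The matrix `[E 0]`. -/
def extE (P : Plant n k m nd ne) (κ : Fin p → Type) : Matrix (Fin ne) (Idx m ⊕ Blk κ) ℝ :=
  Matrix.fromCols P.E 0

/-- The matrix `[F; 0]`. -/
def extF (P : Plant n k m nd ne) (κ : Fin p → Type) : Matrix (Idx k ⊕ Blk κ) (Fin nd) ℝ :=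
  Matrix.fromRows P.F 0

/-- The state matrix of the closed loop. -/
def clA (P : Plant n k m nd ne) (K : Controller κ k m) :
    Matrix (Idx n ⊕ Blk κ) (Idx n ⊕ Blk κ) ℝ :=
  Matrix.fromBlocks P.A 0 0 0 + extB P κ * K.mat * extC P κ

/-- The input matrix of the closed loop. -/
def clB (P : Plant n k m nd ne) (K : Controller κ k m) : Matrix (Idx n ⊕ Blk κ) (Fin nd) ℝ :=
  Matrix.fromRows P.B₀ 0 + extB P κ * K.mat * extF P κ

/-- The output matrix of the closed loop. -/
def clC (P : Plant n k m nd ne) (K : Controller κ k m) : Matrix (Fin ne) (Idx n ⊕ Blk κ) ℝ :=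
  Matrix.fromCols P.C₀ 0 + extE P κ * K.mat * extC P κ

/-- The feedthrough matrix of the closed loop. -/
def clD (P : Plant n k m nd ne) (K : Controller κ k m) : Matrix (Fin ne) (Fin nd) ℝ :=
  P.D₀ + extE P κ * K.mat * extF P κ

/-- The bounded-real LMI of the closed loop, with certificate `𝒳`. -/
def BoundedRealLMI (P : Plant n k m nd ne) (K : Controller κ k m) (γ : ℝ)
    (𝒳 : Matrix (Idx n ⊕ Blk κ) (Idx n ⊕ Blk κ) ℝ) : Prop :=
  𝒳.PosDef ∧
    NegDef (block3
      ((clA P K)ᵀ * 𝒳 + 𝒳 * clA P K) (𝒳 * clB P K)  (clC P K)ᵀ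
      ((clB P K)ᵀ * 𝒳)               (-(γ • 1))     (clD P K)ᵀ
      (clC P K)                      (clD P K)      (-(γ • 1)))

/-- The controller solves the `H∞`-synthesis problem: the closed loop is internally stable and
the `H∞`-norm of `d → e` is smaller than `γ`. -/
def SolvesHinf (P : Plant n k m nd ne) (K : Controller κ k m) (γ : ℝ) : Prop :=
  Hurwitz (clA P K) ∧
    hinfNorm (clA P K) (clB P K) (clC P K) (clD P K) < ENNReal.ofReal γ

end ClosedLoop

/-! ### The synthesis LMIs -/

/-- The decision variables. -/
structure DecVars {p : ℕ} (n : Fin p → ℕ) where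
  Xh : ∀ j : Fin (p + 1), Matrix (Lo (fun i => Fin (n i)) j) (Lo (fun i => Fin (n i)) j) ℝ
  Yh : ∀ j : Fin (p + 1), Matrix (Hi (fun i => Fin (n i)) j) (Hi (fun i => Fin (n i)) j) ℝ
  Zh : ∀ j : Fin (p + 1), Matrix (Hi (fun i => Fin (n i)) j) (Lo (fun i => Fin (n i)) j) ℝ

namespace DecVars

variable {p : ℕ} {n : Fin p → ℕ}

/-- The matrix `X_j = [X̂_j Ẑ_jᵀ; 0 I]`. -/
def X (W : DecVars n) (j : Fin (p + 1)) : Matrix (Idx n) (Idx n) ℝ :=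
  Matrix.reindex (Equiv.sumCompl fun a : Idx n => a.1.val < j.val)
    (Equiv.sumCompl fun a : Idx n => a.1.val < j.val)
    (Matrix.fromBlocks (W.Xh j) (W.Zh j)ᵀ 0 1)

/-- The matrix `Y_j = [I 0; -Ẑ_j Ŷ_j]`. -/
def Y (W : DecVars n) (j : Fin (p + 1)) : Matrix (Idx n) (Idx n) ℝ :=
  Matrix.reindex (Equiv.sumCompl fun a : Idx n => a.1.val < j.val)
    (Equiv.sumCompl fun a : Idx n => a.1.val < j.val)
    (Matrix.fromBlocks 1 0 (-(W.Zh j)) (W.Yh j))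

end DecVars

section Synthesis

variable {p : ℕ} {n k m : Fin p → ℕ} {nd ne : ℕ}

/-- The subspace of which `Γ_j` has to be a basis matrix. -/
def gammaSpace (P : Plant n k m nd ne) (j : Fin (p + 1)) :
    Submodule ℝ (Idx n ⊕ (Fin nd ⊕ Fin ne) → ℝ) :=
  ker (Matrix.fromBlocks
    ((selLc (fun i => Fin (k i)) j)ᵀ * P.C)
    (Matrix.fromCols ((selLc (fun i => Fin (k i)) j)ᵀ * P.F) 0)
    ((selL (fun i => Fin (m i)) j)ᵀ * P.Bᵀ)
    (Matrix.fromCols 0 ((selL (fun i => Fin (m i)) j)ᵀ * P.Eᵀ)))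

/-- The decision variables `W` satisfy the LMIs: the `p + 1` projected ones and the `p` coupling
ones. -/
def Feasible (P : Plant n k m nd ne) (γ : ℝ) {g : Fin (p + 1) → ℕ}
    (Γ : ∀ j, Matrix (Idx n ⊕ (Fin nd ⊕ Fin ne)) (Fin (g j)) ℝ) (W : DecVars n) : Prop :=
  (∀ j, (W.Xh j).IsSymm ∧ (W.Yh j).IsSymm) ∧
  (∀ j : Fin (p + 1), NegDef ((Γ j)ᵀ * block3
      (((W.X j)ᵀ * P.A * W.Y j)ᵀ + (W.X j)ᵀ * P.A * W.Y j) ((W.X j)ᵀ * P.B₀) ((W.Y j)ᵀ * P.C₀ᵀ)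
      (P.B₀ᵀ * W.X j)                                      (-(γ • 1))        P.D₀ᵀ
      (P.C₀ * W.Y j)                                       P.D₀              (-(γ • 1)) * Γ j)) ∧
  (∀ j : Fin p, (Matrix.fromBlocks
      ((W.Y j.castSucc)ᵀ * W.X j.castSucc) ((W.X j.castSucc)ᵀ * W.Y j.succ)
      ((W.Y j.succ)ᵀ * W.X j.castSucc)     ((W.Y j.succ)ᵀ * W.X j.succ)).PosDef)

/-! ### The controller construction -/

/-- The partition of the state of the constructed controller: `p` blocks of dimension
`n 0 + ⋯ + n (p - 1)` each. -/
abbrev KBlk (n : Fin p → ℕ) : Fin p → Type := fun _ => Idx n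

/-- Indices for `p + 1` consecutive blocks of dimension `n 0 + ⋯ + n (p - 1)` each. -/
abbrev Ext (n : Fin p → ℕ) : Type := Fin (p + 1) × Idx n

/-- `(X_0 X_1 ⋯ X_p)`, where `X_0 = I`. -/
def rowX (W : DecVars n) : Matrix (Idx n) (Ext n) ℝ := Matrix.of fun a b => W.X b.1 a b.2

/-- `(Y_0 ⋯ Y_{p-1} Y_p)`, where `Y_p = I`. -/
def rowY (W : DecVars n) : Matrix (Idx n) (Ext n) ℝ := Matrix.of fun a b => W.Y b.1 a b.2

/-- `(0 I)`, i.e. `(U_0 U_1 ⋯ U_p)` with `U_0 = 0` and `(U_1 ⋯ U_p) = I`. -/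
def rowU (n : Fin p → ℕ) : Matrix (Blk (KBlk n)) (Ext n) ℝ :=
  Matrix.of fun a b => if b.1 = a.1.succ ∧ b.2 = a.2 then 1 else 0

/-- `(V_0 ⋯ V_{p-1} 0)`, where the `i`-th block of `V_j` is `Y_{i+1}ᵀ X_j - X_{i+1}ᵀ Y_j` for
`j ≤ i` and `0` otherwise. -/
def rowV (W : DecVars n) : Matrix (Blk (KBlk n)) (Ext n) ℝ :=
  Matrix.of fun a b => if b.1 ≤ a.1.castSucc then
    ((W.Y a.1.succ)ᵀ * W.X b.1 - (W.X a.1.succ)ᵀ * W.Y b.1) a.2 b.2 else 0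

/-- The subspace of which `K_ν` has to be a basis matrix. -/
def kappaSpace (P : Plant n k m nd ne) (W : DecVars n) (ν : Fin p) :
    Submodule ℝ (Ext n ⊕ (Fin nd ⊕ Fin ne) → ℝ) :=
  ker (Matrix.fromBlocks
    ((selLc (fun i => Fin (k i)) ν.castSucc)ᵀ * P.C * rowY W)
    (Matrix.fromCols ((selLc (fun i => Fin (k i)) ν.castSucc)ᵀ * P.F) 0)
    ((selLc (KBlk n) ν.castSucc)ᵀ * rowV W)
    0)

/-- The unstructured parameters `S_0, …, S_{p-1}` of a structured controller. -/
abbrev Params (n k m : Fin p → ℕ) : Type :=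
  ∀ j : Fin p, Matrix (Hi (fun i => Fin (m i)) j.castSucc ⊕ Hi (KBlk n) j.castSucc)
    (Fin (k j) ⊕ Idx n) ℝ

/-- The controller with matrix `[D C; B A] = ∑ j, diag(L_j, L_j) S_j diag(R_jᵀ, R_jᵀ)`. -/
def Params.controller (S : Params n k m) : Controller (KBlk n) k m :=
  Controller.ofMat (∑ j : Fin p,
    Matrix.fromBlocks (selL (fun i => Fin (m i)) j.castSucc) 0 0 (selL (KBlk n) j.castSucc) *
      S j *
      Matrix.fromBlocks (selR (fun i => Fin (k i)) j)ᵀ 0 0 (selR (KBlk n) j)ᵀ)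

/-- The constant term of the inequalities of the controller construction. -/
def stepQ (P : Plant n k m nd ne) (γ : ℝ) (W : DecVars n) :
    Matrix (Ext n ⊕ (Fin nd ⊕ Fin ne)) (Ext n ⊕ (Fin nd ⊕ Fin ne)) ℝ :=
  block3
    ((rowX W)ᵀ * P.A * rowY W) ((rowX W)ᵀ * P.B₀)  0
    0                          (-((γ / 2) • 1))    0
    (P.C₀ * rowY W)            P.D₀                (-((γ / 2) • 1))

/-- The left factor of `S_j` in the inequalities of the controller construction. -/
def stepM (P : Plant n k m nd ne) (W : DecVars n) (j : Fin p) :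
    Matrix (Ext n ⊕ (Fin nd ⊕ Fin ne))
      (Hi (fun i => Fin (m i)) j.castSucc ⊕ Hi (KBlk n) j.castSucc) ℝ :=
  Matrix.fromBlocks
    ((rowX W)ᵀ * P.B * selL (fun i => Fin (m i)) j.castSucc)
    ((rowU n)ᵀ * selL (KBlk n) j.castSucc)
    (Matrix.fromRows 0 (P.E * selL (fun i => Fin (m i)) j.castSucc))
    0

/-- The right factor of `S_j` in the inequalities of the controller construction. -/
def stepN (P : Plant n k m nd ne) (W : DecVars n) (j : Fin p) :
    Matrix (Fin (k j) ⊕ Idx n) (Ext n ⊕ (Fin nd ⊕ Fin ne)) ℝ :=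
  Matrix.fromBlocks
    ((selR (fun i => Fin (k i)) j)ᵀ * P.C * rowY W)
    (Matrix.fromCols ((selR (fun i => Fin (k i)) j)ᵀ * P.F) 0)
    ((selR (KBlk n) j)ᵀ * rowV W)
    0

/-- The `ν`-th inequality of the controller construction. It involves `S_j` for `j ≥ ν` only. -/
def StepLMI (P : Plant n k m nd ne) (γ : ℝ) (W : DecVars n) {h : Fin p → ℕ}
    (Kb : ∀ ν, Matrix (Ext n ⊕ (Fin nd ⊕ Fin ne)) (Fin (h ν)) ℝ) (S : Params n k m)
    (ν : Fin p) : Prop :=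
  NegDef (He ((Kb ν)ᵀ * stepQ P γ W * Kb ν +
    ∑ j ∈ Finset.Ici ν, (Kb ν)ᵀ * (stepM P W j * S j * stepN P W j) * Kb ν))

end Synthesis

end NestedHinf

end

noncomputable section

namespace NestedHinf

/-! ### Definiteness of real matrices -/

section Definite

variable {a b : Type} [Fintype a] [Fintype b]

/-! All matrix inequalities are read as dissipation inequalities. For a certificate `𝒳` and a
closed-loop state `(x, ξ)` with costate `𝒳 (x, ξ) = (q, σ)`, half of the bounded-real form is
`plantForm` in `(q, x, d, e)` plus `ctrlForm`, which pairs the controller matrix with the signals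
`(C x + F d, ξ)` and the co-signals `(Bᵀ q + Eᵀ e, σ)` (`closedLoop_form`).

Necessity. If the signals vanish before block `j` and the co-signals from block `j` on,
triangularity removes the controller term (`ctrlForm_eq_zero`). Minimising the form of `𝒳` over the
controller states from block `j` on provides such `ξ` and `σ`, with `q = Q_j x` for a Schur
complement `Q_j` of `𝒳`. As `j` grows fewer states are eliminated, so `Q_j` increases, strictly
after a small shift. Block elimination writes `Q_j = X_j Y_j⁻¹` with `X_j`, `Y_j` of the prescribed
shapes (`decVarsOf_X_eq`). The negativity found above becomes the projected inequality, and `0 ≺ Q_j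
≺ Q_{j+1}` becomes the coupling inequality by completion of squares (`coupling_form`).

Sufficiency. Conversely the coupling inequalities make `Q_j = X_j Y_j⁻¹` positive definite and
increasing. Then the matrix with blocks `Y_iᵀ Q_{min(i,j)} Y_j` is positive definite, and it equals
`(Y; V)ᵀ (X; U)` for the extended rows (`form_rows`). Hence `(Y; V) w ↦ (X; U) w` is a certificate
that is known before the controller, and the inequality becomes affine in the controller. The
projection lemma (`projection_lemma`) yields the parameters one at a time, the last one first
(`exists_stepLMI`): on one kernel the inequality is the preceding one, on the other only block `ν`
of `w` survives and the projected inequality for `ν` applies.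

Stability and the norm bound follow from the bounded real lemma. -/

lemma posDef_iff_real {M : Matrix a a ℝ} :
    M.PosDef ↔ M.IsSymm ∧ ∀ x : a → ℝ, x ≠ 0 → 0 < x ⬝ᵥ M *ᵥ x := by
  rw [Matrix.posDef_iff_dotProduct_mulVec]
  simp [Matrix.IsHermitian, Matrix.IsSymm, Matrix.conjTranspose_eq_transpose_of_trivial]

lemma dotProduct_self_pos {x : a → ℝ} (hx : x ≠ 0) : 0 < x ⬝ᵥ x :=
  (Finset.sum_nonneg fun i _ => mul_self_nonneg (x i)).lt_of_ne'
    (mt dotProduct_self_eq_zero.1 hx)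

lemma dotProduct_transpose_mulVec (M : Matrix a b ℝ) (x : b → ℝ) (y : a → ℝ) :
    x ⬝ᵥ Mᵀ *ᵥ y = y ⬝ᵥ M *ᵥ x := by
  rw [Matrix.mulVec_transpose, Matrix.dotProduct_mulVec, dotProduct_comm]

lemma IsSymm.dotProduct_mulVec_comm {M : Matrix a a ℝ} (hM : M.IsSymm) (x y : a → ℝ) :
    x ⬝ᵥ M *ᵥ y = y ⬝ᵥ M *ᵥ x := by
  conv_lhs => rw [← hM.eq]
  exact dotProduct_transpose_mulVec M x y

lemma dotProduct_he_mulVec (M : Matrix a a ℝ) (x : a → ℝ) :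
    x ⬝ᵥ He M *ᵥ x = 2 * (x ⬝ᵥ M *ᵥ x) := by
  rw [He, Matrix.add_mulVec, dotProduct_add, dotProduct_transpose_mulVec]
  ring

lemma negDef_he_iff {M : Matrix a a ℝ} :
    NegDef (He M) ↔ ∀ x : a → ℝ, x ≠ 0 → x ⬝ᵥ M *ᵥ x < 0 := by
  rw [NegDef, posDef_iff_real]
  have hs : (-(He M)).IsSymm := by
    simp [Matrix.IsSymm, He, add_comm]
  simp only [hs, true_and, Matrix.neg_mulVec, dotProduct_neg, dotProduct_he_mulVec]
  refine forall₂_congr fun x _ => ?_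
  constructor <;> intro h <;> linarith

lemma dotProduct_congr_mulVec (K : Matrix a b ℝ) (M : Matrix a a ℝ) (x : b → ℝ) :
    x ⬝ᵥ (Kᵀ * M * K) *ᵥ x = (K *ᵥ x) ⬝ᵥ M *ᵥ (K *ᵥ x) := by
  rw [Matrix.mul_assoc, ← Matrix.mulVec_mulVec, dotProduct_transpose_mulVec,
    ← Matrix.mulVec_mulVec, dotProduct_comm]

lemma he_congr {a b : Type} [Fintype a] (K : Matrix a b ℝ) (M : Matrix a a ℝ) :
    He (Kᵀ * M * K) = Kᵀ * He M * K := by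
  simp [He, Matrix.transpose_mul, Matrix.mul_add, Matrix.add_mul, Matrix.mul_assoc]

lemma IsBasisMatrix.negDef_he_iff {K : Matrix a b ℝ} {S : Submodule ℝ (a → ℝ)}
    (hK : IsBasisMatrix K S) {M : Matrix a a ℝ} :
    NegDef (He (Kᵀ * M * K)) ↔ ∀ z ∈ S, z ≠ 0 → z ⬝ᵥ M *ᵥ z < 0 := by
  rw [NestedHinf.negDef_he_iff]
  have hinj : Function.Injective K.mulVec := Matrix.mulVec_injective_iff.2 hK.1
  constructor
  · intro h z hz hz0
    rw [← hK.2] at hz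
    obtain ⟨x, rfl⟩ := hz
    rw [Matrix.mulVecLin_apply, ← dotProduct_congr_mulVec]
    refine h x ?_
    rintro rfl
    simp at hz0
  · intro h x hx
    rw [dotProduct_congr_mulVec]
    refine h _ ?_ ?_
    · rw [← hK.2]
      exact ⟨x, rfl⟩
    · intro h0
      exact hx (hinj (by simpa using h0))

lemma exists_isBasisMatrix (S : Submodule ℝ (a → ℝ)) :
    ∃ (h : ℕ) (K : Matrix a (Fin h) ℝ), IsBasisMatrix K S := by
  let B := Module.finBasis ℝ S
  refine ⟨_, Matrix.of fun i j => (B j : a → ℝ) i, ?_, ?_⟩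
  · exact B.linearIndependent.map' S.subtype (Submodule.ker_subtype S)
  · rw [Matrix.range_mulVecLin]
    have hr : Set.range (Matrix.of fun i j => (B j : a → ℝ) i).col = S.subtype '' Set.range B := by
      rw [← Set.range_comp]
      rfl
    rw [hr, Submodule.span_image, B.span_eq, Submodule.map_top, Submodule.range_subtype]

end Definite

/-! ### The projection lemma -/

section Projection

variable {V W : Type*} [AddCommGroup V] [Module ℝ V] [AddCommGroup W] [Module ℝ W]

/-- A linear map on one subspace that vanishes on the intersection with a second one extends to the
whole space so as to vanish on the second subspace. -/
lemma exists_extend_vanishing (U₁ U₂ : Submodule ℝ V) (f : U₁ →ₗ[ℝ] W)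
    (hf : ∀ x : U₁, (x : V) ∈ U₂ → f x = 0) :
    ∃ g : V →ₗ[ℝ] W, (∀ x : U₁, g x = f x) ∧ ∀ x ∈ U₂, g x = 0 := by
  let f₁ : V →ₗ.[ℝ] W := ⟨U₁, f⟩
  let f₂ : V →ₗ.[ℝ] W := ⟨U₂, 0⟩
  have h : ∀ (x : f₁.domain) (y : f₂.domain), (x : V) = y → f₁ x = f₂ y := by
    intro x y hxy
    exact hf x (by rw [hxy]; exact y.2)
  obtain ⟨g, hg⟩ := LinearMap.exists_extend (f₁.sup f₂ h).toFun
  refine ⟨g, fun x => ?_, fun x hx => ?_⟩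
  · have h1 := (LinearPMap.left_le_sup f₁ f₂ h).2 (x := x)
      (y := ⟨x, (LinearPMap.left_le_sup f₁ f₂ h).1 x.2⟩) rfl
    have h2 := LinearMap.congr_fun hg ⟨x, (LinearPMap.left_le_sup f₁ f₂ h).1 x.2⟩
    exact h2.trans h1.symm
  · have h1 := (LinearPMap.right_le_sup f₁ f₂ h).2 (x := ⟨x, hx⟩)
      (y := ⟨x, (LinearPMap.right_le_sup f₁ f₂ h).1 hx⟩) rfl
    have h2 := LinearMap.congr_fun hg ⟨x, (LinearPMap.right_le_sup f₁ f₂ h).1 hx⟩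
    exact h2.trans h1.symm

/-- A symmetric form that is negative definite on a subspace admits an orthogonal projection onto
that subspace. -/
lemma exists_orthogonal_projection [FiniteDimensional ℝ V] (H : LinearMap.BilinForm ℝ V)
    (hH : ∀ u v, H u v = H v u) (U : Submodule ℝ V) (hU : ∀ u ∈ U, u ≠ 0 → H u u < 0) :
    ∃ P : V →ₗ[ℝ] V, (∀ v, P v ∈ U) ∧ (∀ u ∈ U, P u = u) ∧
      ∀ u ∈ U, ∀ v, P v = 0 → H u v = 0 := by
  have hr : H.IsRefl := fun u v h => by rw [hH, h]
  have hd : Disjoint U (H.orthogonal U) := by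
    rw [Submodule.disjoint_def]
    intro x hx hx'
    by_contra h0
    have h1 := hU x hx h0
    have h2 : H x x = 0 := hx' x hx
    linarith
  have hc : IsCompl U (H.orthogonal U) :=
    (LinearMap.BilinForm.isCompl_orthogonal_iff_disjoint hr).2 hd
  refine ⟨U.subtype ∘ₗ U.projectionOnto _ hc, fun v => (U.projectionOnto _ hc v).2, ?_, ?_⟩
  · intro u hu
    have := Submodule.projectionOnto_apply_left hc ⟨u, hu⟩
    simp [this]
  · intro u hu v hv
    have hvU : U.projectionOnto _ hc v = 0 := Subtype.ext hv
    rw [Submodule.projectionOnto_apply_eq_zero_iff] at hvU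
    exact hvU u hu

/-- The projection lemma for bilinear forms. -/
lemma exists_bilin_neg [FiniteDimensional ℝ V] (H G : LinearMap.BilinForm ℝ V)
    (hH : ∀ u v, H u v = H v u) (hG : ∀ v, v ≠ 0 → 0 < G v v) (U₁ U₂ : Submodule ℝ V)
    (h₁ : ∀ u ∈ U₁, u ≠ 0 → H u u < 0) (h₂ : ∀ u ∈ U₂, u ≠ 0 → H u u < 0) :
    ∃ β : LinearMap.BilinForm ℝ V, (∀ u ∈ U₂, ∀ v, β u v = 0) ∧ (∀ v ∈ U₁, ∀ u, β u v = 0) ∧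
      ∀ v, v ≠ 0 → H v v + 2 * β v v < 0 := by
  obtain ⟨P, hPm, hPi, hPo⟩ := exists_orthogonal_projection H hH (U₁ ⊓ U₂)
    fun u hu => h₁ u hu.1
  have hPP : ∀ v, P (v - P v) = 0 := fun v => by rw [map_sub, hPi _ (hPm v), sub_self]
  -- A vector is split into its part `P v` in `U₁ ⊓ U₂`, remainders in `U₁` and in `U₂`, and a rest
  -- on which nothing is known about `H`. `key` provides the two remainders.
  have key : ∀ A B : Submodule ℝ V, (∀ v, P v ∈ A) → (∀ u ∈ A, u ∈ B → P u = u) →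
      ∃ π : V →ₗ[ℝ] V, (∀ v, π v ∈ A ∧ P (π v) = 0) ∧ (∀ v ∈ A, π v = v - P v) ∧
        ∀ v ∈ B, π v = 0 := by
    intro A B hA hAB
    let f : A →ₗ[ℝ] (A ⊓ LinearMap.ker P : Submodule ℝ V) :=
      LinearMap.codRestrict _ ((LinearMap.id - P) ∘ₗ A.subtype)
        fun v => ⟨A.sub_mem v.2 (hA v), LinearMap.mem_ker.2 (hPP v)⟩
    obtain ⟨g, hg1, hg2⟩ := exists_extend_vanishing A B f (fun x hx => by
      apply Subtype.ext
      change (x : V) - P x = 0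
      rw [hAB x x.2 hx, sub_self])
    refine ⟨Submodule.subtype _ ∘ₗ g, fun v => (g v).2, fun v hv => ?_, fun v hv => ?_⟩
    · change ((g v : _) : V) = _
      rw [hg1 ⟨v, hv⟩]
      rfl
    · change ((g v : _) : V) = _
      rw [hg2 v hv]
      rfl
  obtain ⟨π₁, hm₁, hi₁, hz₁⟩ := key U₁ U₂ (fun v => (hPm v).1) fun u hu hu' => hPi u ⟨hu, hu'⟩
  obtain ⟨π₂, hm₂, hi₂, hz₂⟩ := key U₂ U₁ (fun v => (hPm v).2) fun u hu hu' => hPi u ⟨hu', hu⟩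
  let π₃ : V →ₗ[ℝ] V := LinearMap.id - P - π₁ - π₂
  have h3 : ∀ v, π₃ v = v - P v - π₁ v - π₂ v := fun v => rfl
  have hsum : ∀ v, v = P v + π₁ v + π₂ v + π₃ v := fun v => by rw [h3]; abel
  have hz₃ : ∀ v ∈ U₁, π₃ v = 0 := fun v hv => by rw [h3, hi₁ v hv, hz₂ v hv]; abel
  have hz₃' : ∀ v ∈ U₂, π₃ v = 0 := fun v hv => by rw [h3, hi₂ v hv, hz₁ v hv]; abel
  have hP₃ : ∀ v, P (π₃ v) = 0 := fun v => by
    rw [h3, map_sub, map_sub, hPP, (hm₁ v).2, (hm₂ v).2]; simp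
  -- Adding `2β` cancels the cross terms of `H` and replaces its value on the rest by `-G`. The
  -- order of the arguments in the cross terms matters: `π₁` and `π₃` vanish on `U₂`, `π₂` and `π₃`
  -- vanish on `U₁`, so `β` vanishes where required.
  let β : LinearMap.BilinForm ℝ V :=
    -(H.compl₁₂ π₁ π₂) - H.compl₁₂ π₁ π₃ - H.compl₁₂ π₃ π₂
      - (1 / 2 : ℝ) • (H.compl₁₂ π₃ π₃ + G.compl₁₂ π₃ π₃)
  have hβ : ∀ u v, β u v = -H (π₁ u) (π₂ v) - H (π₁ u) (π₃ v) - H (π₃ u) (π₂ v)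
      - (1 / 2 : ℝ) * (H (π₃ u) (π₃ v) + G (π₃ u) (π₃ v)) := fun u v => rfl
  refine ⟨β, fun u hu v => ?_, fun v hv u => ?_, fun v hv => ?_⟩
  · rw [hβ, hz₁ u hu, hz₃' u hu]; simp
  · rw [hβ, hz₂ v hv, hz₃ v hv]; simp
  · have e : H v v = H (P v) (P v) + H (π₁ v) (π₁ v) + H (π₂ v) (π₂ v) + H (π₃ v) (π₃ v)
        + 2 * H (π₁ v) (π₂ v) + 2 * H (π₁ v) (π₃ v) + 2 * H (π₃ v) (π₂ v) := by
      conv_lhs => rw [hsum v]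
      simp only [map_add, LinearMap.add_apply]
      rw [hPo _ (hPm v) _ (hm₁ v).2, hPo _ (hPm v) _ (hm₂ v).2, hPo _ (hPm v) _ (hP₃ v),
        hH (π₁ v) (P v), hH (π₂ v) (P v), hH (π₃ v) (P v),
        hPo _ (hPm v) _ (hm₁ v).2, hPo _ (hPm v) _ (hm₂ v).2, hPo _ (hPm v) _ (hP₃ v),
        hH (π₂ v) (π₁ v), hH (π₃ v) (π₁ v), hH (π₂ v) (π₃ v)]
      ring
    have nonpos : ∀ U : Submodule ℝ V, (∀ u ∈ U, u ≠ 0 → H u u < 0) → ∀ u ∈ U,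
        H u u ≤ 0 ∧ (H u u = 0 → u = 0) := by
      intro U hU u hu
      by_cases h0 : u = 0
      · simp [h0]
      · have := hU u hu h0
        exact ⟨this.le, fun h => by linarith⟩
    have n0 := nonpos U₁ h₁ _ (hPm v).1
    have n1 := nonpos U₁ h₁ _ (hm₁ v).1
    have n2 := nonpos U₂ h₂ _ (hm₂ v).1
    have n3 : 0 ≤ G (π₃ v) (π₃ v) ∧ (G (π₃ v) (π₃ v) = 0 → π₃ v = 0) := by
      by_cases h0 : π₃ v = 0
      · simp [h0]
      · have := hG _ h0
        exact ⟨this.le, fun h => by linarith⟩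
    rw [hβ, e]
    by_contra hcon
    refine hv ?_
    have z0 := n0.2 (by linarith [n0.1, n1.1, n2.1, n3.1])
    have z1 := n1.2 (by linarith [n0.1, n1.1, n2.1, n3.1])
    have z2 := n2.2 (by linarith [n0.1, n1.1, n2.1, n3.1])
    have z3 := n3.2 (by linarith [n0.1, n1.1, n2.1, n3.1])
    rw [hsum v, z0, z1, z2, z3]
    simp

/-- Every linear map of vector spaces has a generalized inverse. -/
lemma exists_generalized_inverse (f : V →ₗ[ℝ] W) : ∃ g : W →ₗ[ℝ] V, ∀ v, f (g (f v)) = f v := by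
  obtain ⟨s, hs⟩ := LinearMap.exists_rightInverse_of_surjective f.rangeRestrict
    (LinearMap.range_rangeRestrict f)
  obtain ⟨g, hg⟩ := LinearMap.exists_extend s
  refine ⟨g, fun v => ?_⟩
  have h1 : g (f v) = s (f.rangeRestrict v) := LinearMap.congr_fun hg (f.rangeRestrict v)
  have h2 := LinearMap.congr_fun hs (f.rangeRestrict v)
  rw [h1]
  exact congrArg Subtype.val h2

end Projection

/-! ### The projection lemma for matrices and the openness of definiteness -/

section MatrixProjection

variable {a b c : Type} [Fintype a] [Fintype b] [Fintype c]

/-- A matrix factors through two given ones if its kernels contain theirs. -/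
lemma exists_factorization (T : Matrix a a ℝ) (M : Matrix a b ℝ) (N : Matrix c a ℝ)
    (hN : ∀ v, N *ᵥ v = 0 → T *ᵥ v = 0) (hM : ∀ u, Mᵀ *ᵥ u = 0 → Tᵀ *ᵥ u = 0) :
    ∃ S : Matrix b c ℝ, T = M * S * N := by
  classical
  have key : ∀ {a c : Type} [Fintype a] [Fintype c] [DecidableEq a] [DecidableEq c]
      (T : Matrix a a ℝ) (N : Matrix c a ℝ), (∀ v, N *ᵥ v = 0 → T *ᵥ v = 0) →
      ∃ R : Matrix a c ℝ, T * R * N = T := by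
    intro a c _ _ _ _ T N h
    obtain ⟨g, hg⟩ := exists_generalized_inverse N.mulVecLin
    refine ⟨LinearMap.toMatrix' g, Matrix.mulVec_injective (funext fun v => ?_)⟩
    have h1 : N *ᵥ (g (N *ᵥ v) - v) = 0 := by
      rw [Matrix.mulVec_sub, sub_eq_zero]
      exact hg v
    have h2 := h _ h1
    rw [Matrix.mulVec_sub, sub_eq_zero] at h2
    rw [← Matrix.mulVec_mulVec, ← Matrix.mulVec_mulVec, LinearMap.toMatrix'_mulVec, h2]
  obtain ⟨R, hR⟩ := key T N hN
  obtain ⟨L, hL⟩ := key Tᵀ Mᵀ hM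
  have hL' : M * Lᵀ * T = T := by
    have := congrArg Matrix.transpose hL
    simpa [Matrix.transpose_mul, Matrix.mul_assoc] using this
  refine ⟨Lᵀ * T * R, ?_⟩
  calc T = M * Lᵀ * (T * R * N) := by rw [hR, hL']
    _ = _ := by simp only [Matrix.mul_assoc]

/-- The projection lemma: `Q + M S N` can be rendered negative definite by the choice of `S` if `Q`
is negative definite on the kernels of `N` and `Mᵀ`. -/
lemma projection_lemma (Q : Matrix a a ℝ) (M : Matrix a b ℝ) (N : Matrix c a ℝ)
    (hN : ∀ z, z ≠ 0 → N *ᵥ z = 0 → z ⬝ᵥ Q *ᵥ z < 0)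
    (hM : ∀ z, z ≠ 0 → Mᵀ *ᵥ z = 0 → z ⬝ᵥ Q *ᵥ z < 0) :
    ∃ S : Matrix b c ℝ, ∀ z, z ≠ 0 → z ⬝ᵥ (Q + M * S * N) *ᵥ z < 0 := by
  classical
  have hform : ∀ (A : Matrix a a ℝ) u v, Matrix.toLinearMap₂' ℝ A u v = u ⬝ᵥ A *ᵥ v :=
    fun A u v => Matrix.toLinearMap₂'_apply' A u v
  have hsym : (He Q).IsSymm := by simp [Matrix.IsSymm, He, add_comm]
  obtain ⟨β, hβ₂, hβ₁, hβ⟩ := exists_bilin_neg (Matrix.toLinearMap₂' ℝ (He Q))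
    (Matrix.toLinearMap₂' ℝ (1 : Matrix a a ℝ))
    (fun u v => by rw [hform, hform]; exact IsSymm.dotProduct_mulVec_comm hsym u v)
    (fun v hv => by
      rw [hform, Matrix.one_mulVec]
      exact dotProduct_self_pos hv)
    (LinearMap.ker N.mulVecLin) (LinearMap.ker Mᵀ.mulVecLin)
    (fun u hu h0 => by rw [hform, dotProduct_he_mulVec]; linarith [hN u h0 hu])
    (fun u hu h0 => by rw [hform, dotProduct_he_mulVec]; linarith [hM u h0 hu])
  let T : Matrix a a ℝ := LinearMap.toMatrix₂' ℝ β
  have hT : ∀ u v, u ⬝ᵥ T *ᵥ v = β u v := fun u v => by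
    rw [← hform, Matrix.toLinearMap₂'_toMatrix']
  -- The vanishing of `β` in its two arguments is the kernel condition under which its matrix has
  -- the form `M S N`.
  obtain ⟨S, hS⟩ := exists_factorization T M N
    (fun v hv => by
      refine dotProduct_eq_zero _ fun u => ?_
      rw [dotProduct_comm, hT, hβ₁ v hv])
    (fun u hu => by
      refine dotProduct_eq_zero _ fun v => ?_
      rw [dotProduct_comm, dotProduct_transpose_mulVec, hT, hβ₂ u hu])
  refine ⟨S, fun z hz => ?_⟩
  have := hβ z hz
  rw [hform, dotProduct_he_mulVec, ← hT] at this
  rw [← hS, Matrix.add_mulVec, dotProduct_add]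
  linarith

/-- Negative definiteness on a subspace is an open condition. -/
lemma eventually_neg_on (S : Submodule ℝ (a → ℝ)) (f : ℝ → Matrix a a ℝ) (hf : ContinuousAt f 0)
    (h : ∀ z ∈ S, z ≠ 0 → z ⬝ᵥ f 0 *ᵥ z < 0) :
    ∀ᶠ ε in nhds (0 : ℝ), ∀ z ∈ S, z ≠ 0 → z ⬝ᵥ f ε *ᵥ z < 0 := by
  -- Compactness of the unit sphere of `S` makes the pointwise statement uniform; homogeneity covers
  -- the other vectors.
  have hK : IsCompact ((S : Set (a → ℝ)) ∩ Metric.sphere 0 1) :=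
    (isCompact_sphere 0 1).inter_left S.closed_of_finiteDimensional
  have hev := hK.eventually_forall_of_forall_eventually (x₀ := (0 : ℝ))
    (P := fun ε z => z ⬝ᵥ f ε *ᵥ z < 0) (by
      rintro z ⟨hz, hz1⟩
      have hz0 : z ≠ 0 := by
        rintro rfl
        simp at hz1
      have hc : ContinuousAt (fun q : ℝ × (a → ℝ) => q.2 ⬝ᵥ f q.1 *ᵥ q.2) (0, z) := by
        have hm : Continuous fun q : Matrix a a ℝ × (a → ℝ) => q.2 ⬝ᵥ q.1 *ᵥ q.2 := by fun_prop
        have hg : ContinuousAt (fun q : ℝ × (a → ℝ) => (f q.1, q.2)) (0, z) :=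
          (ContinuousAt.comp (f := Prod.fst) (x := ((0 : ℝ), z)) hf continuousAt_fst).prodMk
            continuousAt_snd
        exact hm.continuousAt.comp hg
      exact hc.eventually_lt continuousAt_const (h z hz hz0))
  filter_upwards [hev] with ε hε z hz hz0
  have hn : 0 < ‖z‖ := norm_pos_iff.2 hz0
  have := hε (‖z‖⁻¹ • z) ⟨S.smul_mem _ hz, by simp [norm_smul, hn.ne']⟩
  rw [Matrix.mulVec_smul, smul_dotProduct, dotProduct_smul, smul_eq_mul, smul_eq_mul] at this
  have h2 : 0 < ‖z‖⁻¹ := inv_pos.2 hn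
  by_contra hcon
  rw [not_lt] at hcon
  have := mul_nonneg h2.le (mul_nonneg h2.le hcon)
  linarith

end MatrixProjection

/-! ### The quadratic forms of the matrix inequalities -/

section Forms

variable {a b c : Type} [Fintype a] [Fintype b] [Fintype c]

/-- Half of the quadratic form of a bounded-real inequality, where `q` stands for the costate that
belongs to the state `x`. -/
def dissForm {a : Type} [Fintype a] (A : Matrix a a ℝ) (B : Matrix a b ℝ) (C : Matrix c a ℝ)
    (D : Matrix c b ℝ) (γ : ℝ) (q x : a → ℝ) (d : b → ℝ) (e : c → ℝ) : ℝ :=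
  q ⬝ᵥ (A *ᵥ x + B *ᵥ d) + e ⬝ᵥ (C *ᵥ x + D *ᵥ d) - γ / 2 * (d ⬝ᵥ d) - γ / 2 * (e ⬝ᵥ e)

lemma sumElim_dotProduct_sumElim (x x' : a → ℝ) (y y' : b → ℝ) :
    Sum.elim x y ⬝ᵥ Sum.elim x' y' = x ⬝ᵥ x' + y ⬝ᵥ y' := by
  simp [dotProduct, Fintype.sum_sum_type]

lemma exists_sumElim₃ {a b c : Type} (z : a ⊕ (b ⊕ c) → ℝ) :
    ∃ v d e, z = Sum.elim v (Sum.elim d e) :=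
  ⟨z ∘ Sum.inl, z ∘ Sum.inr ∘ Sum.inl, z ∘ Sum.inr ∘ Sum.inr, by
    ext (i | i | i) <;> rfl⟩

lemma sumElim_ne_zero_iff {a b : Type} {x : a → ℝ} {y : b → ℝ} :
    Sum.elim x y ≠ 0 ↔ x ≠ 0 ∨ y ≠ 0 := by
  rw [← not_and_or, not_iff_not]
  constructor
  · intro h
    exact ⟨funext fun i => congrFun h (Sum.inl i), funext fun i => congrFun h (Sum.inr i)⟩
  · rintro ⟨rfl, rfl⟩
    ext (i | i) <;> rfl

variable [DecidableEq b] [DecidableEq c]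

lemma dotProduct_block3_mulVec (M₁₁ : Matrix a a ℝ) (M₁₂ : Matrix a b ℝ) (M₃₁ : Matrix c a ℝ)
    (M₃₂ : Matrix c b ℝ) (γ : ℝ) (v : a → ℝ) (d : b → ℝ) (e : c → ℝ) :
    Sum.elim v (Sum.elim d e) ⬝ᵥ
      (block3 M₁₁ M₁₂ 0 0 (-((γ / 2) • 1)) 0 M₃₁ M₃₂ (-((γ / 2) • 1))) *ᵥ
        Sum.elim v (Sum.elim d e) = dissForm M₁₁ M₁₂ M₃₁ M₃₂ γ v v d e := by
  rw [block3, Matrix.fromBlocks_mulVec, Sum.elim_comp_inl, Sum.elim_comp_inr,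
    Matrix.fromBlocks_mulVec, Sum.elim_comp_inl, Sum.elim_comp_inr, Matrix.fromRows_mulVec,
    Matrix.fromCols_mulVec, Sum.elim_comp_inl, Sum.elim_comp_inr, ← Sum.elim_add_add,
    sumElim_dotProduct_sumElim, sumElim_dotProduct_sumElim]
  simp only [Matrix.zero_mulVec, Matrix.neg_mulVec, Matrix.smul_mulVec, Matrix.one_mulVec,
    dotProduct_add, dotProduct_neg, dotProduct_smul, dotProduct_zero, smul_eq_mul, dissForm]
  ring

lemma block3_eq_he {a b c : Type} [DecidableEq b] [DecidableEq c]
    (M₁₁ : Matrix a a ℝ) (M₁₂ : Matrix a b ℝ) (M₃₁ : Matrix c a ℝ)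
    (M₃₂ : Matrix c b ℝ) (γ : ℝ) :
    block3 (M₁₁ᵀ + M₁₁) M₁₂ M₃₁ᵀ M₁₂ᵀ (-(γ • 1)) M₃₂ᵀ M₃₁ M₃₂ (-(γ • 1)) =
      He (block3 M₁₁ M₁₂ 0 0 (-((γ / 2) • 1)) 0 M₃₁ M₃₂ (-((γ / 2) • 1))) := by
  have h1 : ∀ {b : Type} [DecidableEq b] (i j : b),
      -(γ * (1 : Matrix b b ℝ) i j) =
        -(γ / 2 * (1 : Matrix b b ℝ) j i) + -(γ / 2 * (1 : Matrix b b ℝ) i j) := by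
    intro b _ i j
    rw [← Matrix.transpose_apply (1 : Matrix b b ℝ), Matrix.transpose_one]
    ring
  ext (i | i | i) (j | j | j) <;> simp [block3, He, h1]

end Forms

section Selection

variable {p : ℕ} (κ : Fin p → Type) [∀ i, Fintype (κ i)] [∀ i, DecidableEq (κ i)]

lemma selLc_transpose_mulVec (j : Fin (p + 1)) (w : Blk κ → ℝ) :
    (selLc κ j)ᵀ *ᵥ w = fun a => w a.1 := by
  rw [selLc, Matrix.transpose_submatrix, Matrix.transpose_one,
    show ((1 : Matrix (Blk κ) (Blk κ) ℝ).submatrix (Subtype.val : Lo κ j → Blk κ) id) *ᵥ w =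
      ((1 : Matrix (Blk κ) (Blk κ) ℝ) *ᵥ w) ∘ Subtype.val from rfl, Matrix.one_mulVec]
  rfl

lemma selL_transpose_mulVec (j : Fin (p + 1)) (w : Blk κ → ℝ) :
    (selL κ j)ᵀ *ᵥ w = fun a => w a.1 := by
  rw [selL, Matrix.transpose_submatrix, Matrix.transpose_one,
    show ((1 : Matrix (Blk κ) (Blk κ) ℝ).submatrix (Subtype.val : Hi κ j → Blk κ) id) *ᵥ w =
      ((1 : Matrix (Blk κ) (Blk κ) ℝ) *ᵥ w) ∘ Subtype.val from rfl, Matrix.one_mulVec]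
  rfl

lemma selR_transpose_mulVec (j : Fin p) (w : Blk κ → ℝ) :
    (selR κ j)ᵀ *ᵥ w = fun i => w ⟨j, i⟩ := by
  rw [selR, Matrix.transpose_submatrix, Matrix.transpose_one,
    show ((1 : Matrix (Blk κ) (Blk κ) ℝ).submatrix (Sigma.mk j) id) *ᵥ w =
      ((1 : Matrix (Blk κ) (Blk κ) ℝ) *ᵥ w) ∘ Sigma.mk j from rfl, Matrix.one_mulVec]
  rfl

end Selection

/-! ### The projected inequalities as conditions on quadratic forms -/

section Gamma

variable {p : ℕ} {n k m : Fin p → ℕ} {nd ne : ℕ} (P : Plant n k m nd ne)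

/-- The signals injected into the controller inputs of the plant costate: `Bᵀ q + Eᵀ e`. -/
def coInput (q : Idx n → ℝ) (e : Fin ne → ℝ) : Idx m → ℝ := P.Bᵀ *ᵥ q + P.Eᵀ *ᵥ e

/-- The measured output `C x + F d`. -/
def measOut (x : Idx n → ℝ) (d : Fin nd → ℝ) : Idx k → ℝ := P.C *ᵥ x + P.F *ᵥ d

/-- The supply form of the plant without control. -/
abbrev plantForm (γ : ℝ) (q x : Idx n → ℝ) (d : Fin nd → ℝ) (e : Fin ne → ℝ) : ℝ :=
  dissForm P.A P.B₀ P.C₀ P.D₀ γ q x d e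

lemma mem_gammaSpace (j : Fin (p + 1)) (v : Idx n → ℝ) (d : Fin nd → ℝ) (e : Fin ne → ℝ) :
    Sum.elim v (Sum.elim d e) ∈ gammaSpace P j ↔
      (∀ a : Idx k, a.1.val < j.val → measOut P v d a = 0) ∧
      (∀ b : Idx m, ¬ b.1.val < j.val → coInput P v e b = 0) := by
  rw [gammaSpace, ker, LinearMap.mem_ker, Matrix.mulVecLin_apply, Matrix.fromBlocks_mulVec,
    Sum.elim_comp_inl, Sum.elim_comp_inr, Matrix.fromCols_mulVec, Matrix.fromCols_mulVec,
    Sum.elim_comp_inl, Sum.elim_comp_inr, Matrix.zero_mulVec, Matrix.zero_mulVec, add_zero,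
    zero_add, ← Matrix.mulVec_mulVec, ← Matrix.mulVec_mulVec, ← Matrix.mulVec_mulVec,
    ← Matrix.mulVec_mulVec, ← Matrix.mulVec_add, ← Matrix.mulVec_add, selLc_transpose_mulVec,
    selL_transpose_mulVec]
  constructor
  · intro h
    exact ⟨fun a ha => congrFun h (Sum.inl ⟨a, ha⟩), fun b hb => congrFun h (Sum.inr ⟨b, hb⟩)⟩
  · rintro ⟨h1, h2⟩
    ext (i | i)
    · exact h1 i.1 i.2
    · exact h2 i.1 i.2

/-- The projected inequality for a pair `X`, `Y`, in terms of quadratic forms. -/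
def ProjNeg (γ : ℝ) (X Y : Matrix (Idx n) (Idx n) ℝ) (j : Fin (p + 1)) : Prop :=
  ∀ v d e, (v ≠ 0 ∨ d ≠ 0 ∨ e ≠ 0) →
    (∀ a : Idx k, a.1.val < j.val → measOut P v d a = 0) →
    (∀ b : Idx m, ¬ b.1.val < j.val → coInput P v e b = 0) →
    plantForm P γ (X *ᵥ v) (Y *ᵥ v) d e < 0

/-- The congruence is absorbed into costate and state. This serves a single pair `X_j`, `Y_j` as
well as the wide matrices `rowX`, `rowY`. -/
lemma dissForm_congr {a : Type} [Fintype a] (X Y : Matrix (Idx n) a ℝ) (γ : ℝ) (v : a → ℝ)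
    (d : Fin nd → ℝ) (e : Fin ne → ℝ) :
    dissForm (Xᵀ * P.A * Y) (Xᵀ * P.B₀) (P.C₀ * Y) P.D₀ γ v v d e =
      plantForm P γ (X *ᵥ v) (Y *ᵥ v) d e := by
  rw [plantForm, dissForm, dissForm, Matrix.mul_assoc, ← Matrix.mulVec_mulVec,
    ← Matrix.mulVec_mulVec, ← Matrix.mulVec_mulVec, ← Matrix.mulVec_mulVec, ← Matrix.mulVec_add,
    dotProduct_transpose_mulVec, dotProduct_comm (P.A *ᵥ _ + _)]

/-- Half of the matrix in the projected inequality. -/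
def projMat (γ : ℝ) (X Y : Matrix (Idx n) (Idx n) ℝ) :
    Matrix (Idx n ⊕ (Fin nd ⊕ Fin ne)) (Idx n ⊕ (Fin nd ⊕ Fin ne)) ℝ :=
  block3 (Xᵀ * P.A * Y) (Xᵀ * P.B₀) 0 0 (-((γ / 2) • 1)) 0 (P.C₀ * Y) P.D₀ (-((γ / 2) • 1))

lemma projNeg_iff (γ : ℝ) (X Y : Matrix (Idx n) (Idx n) ℝ) (j : Fin (p + 1)) :
    ProjNeg P γ X Y j ↔ ∀ z ∈ gammaSpace P j, z ≠ 0 → z ⬝ᵥ projMat P γ X Y *ᵥ z < 0 := by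
  constructor
  · intro h z hz hz0
    obtain ⟨v, d, e, rfl⟩ := exists_sumElim₃ z
    rw [projMat, dotProduct_block3_mulVec, dissForm_congr]
    rw [mem_gammaSpace] at hz
    rw [sumElim_ne_zero_iff, sumElim_ne_zero_iff] at hz0
    exact h v d e hz0 hz.1 hz.2
  · intro h v d e h0 h1 h2
    have := h (Sum.elim v (Sum.elim d e)) ((mem_gammaSpace P j v d e).2 ⟨h1, h2⟩)
      (by rwa [sumElim_ne_zero_iff, sumElim_ne_zero_iff])
    rwa [projMat, dotProduct_block3_mulVec, dissForm_congr] at this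

lemma negDef_proj_iff (γ : ℝ) (X Y : Matrix (Idx n) (Idx n) ℝ) (j : Fin (p + 1)) {g : ℕ}
    {Γ : Matrix (Idx n ⊕ (Fin nd ⊕ Fin ne)) (Fin g) ℝ} (hΓ : IsBasisMatrix Γ (gammaSpace P j)) :
    NegDef (Γᵀ * block3
      ((Xᵀ * P.A * Y)ᵀ + Xᵀ * P.A * Y) (Xᵀ * P.B₀) (Yᵀ * P.C₀ᵀ)
      (P.B₀ᵀ * X)                      (-(γ • 1))  P.D₀ᵀ
      (P.C₀ * Y)                       P.D₀        (-(γ • 1)) * Γ) ↔ ProjNeg P γ X Y j := by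
  have h : block3
      ((Xᵀ * P.A * Y)ᵀ + Xᵀ * P.A * Y) (Xᵀ * P.B₀) (Yᵀ * P.C₀ᵀ)
      (P.B₀ᵀ * X)                      (-(γ • 1))  P.D₀ᵀ
      (P.C₀ * Y)                       P.D₀        (-(γ • 1)) = He (projMat P γ X Y) := by
    rw [projMat, ← block3_eq_he, Matrix.transpose_mul P.C₀, Matrix.transpose_mul _ P.B₀,
      Matrix.transpose_transpose]
  rw [h, ← he_congr, hΓ.negDef_he_iff, projNeg_iff]

end Gamma

/-! ### The closed-loop form split into plant and controller -/

section ClosedLoopForm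

variable {p : ℕ} {n k m : Fin p → ℕ} {nd ne : ℕ} {κ : Fin p → Type}
  [∀ i, Fintype (κ i)] [∀ i, DecidableEq (κ i)] (P : Plant n k m nd ne)

/-- The contribution of a controller with matrix `M = [D C; B A]` to the supply form. -/
def ctrlForm (M : Matrix (Idx m ⊕ Blk κ) (Idx k ⊕ Blk κ) ℝ) (q x : Idx n → ℝ) (σ ξ : Blk κ → ℝ)
    (d : Fin nd → ℝ) (e : Fin ne → ℝ) : ℝ :=
  Sum.elim (coInput P q e) σ ⬝ᵥ M *ᵥ Sum.elim (measOut P x d) ξ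

/-- The controller matrix acts on the signals `[C 0; 0 I] (x, ξ) + [F; 0] d`, and its output is
tested against `[B 0; 0 I]ᵀ (q, σ) + [E 0]ᵀ e`. The form is thus affine in that matrix. -/
lemma closedLoop_form (K : Controller κ k m) (γ : ℝ) (q x : Idx n → ℝ) (σ ξ : Blk κ → ℝ)
    (d : Fin nd → ℝ) (e : Fin ne → ℝ) :
    dissForm (clA P K) (clB P K) (clC P K) (clD P K) γ (Sum.elim q σ) (Sum.elim x ξ) d e =
      plantForm P γ q x d e + ctrlForm P K.mat q x σ ξ d e := by
  have hy : extC P κ *ᵥ Sum.elim x ξ + extF P κ *ᵥ d = Sum.elim (measOut P x d) ξ := by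
    rw [extC, extF, Matrix.fromBlocks_mulVec, Matrix.fromRows_mulVec, Sum.elim_comp_inl,
      Sum.elim_comp_inr, ← Sum.elim_add_add]
    simp [measOut]
  have h1 : clA P K *ᵥ Sum.elim x ξ + clB P K *ᵥ d =
      Sum.elim (P.A *ᵥ x + P.B₀ *ᵥ d) 0 +
        extB P κ *ᵥ (K.mat *ᵥ Sum.elim (measOut P x d) ξ) := by
    rw [← hy, Matrix.mulVec_add, Matrix.mulVec_add, clA, clB, Matrix.add_mulVec,
      Matrix.add_mulVec, Matrix.fromBlocks_mulVec, Matrix.fromRows_mulVec]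
    simp only [← Matrix.mulVec_mulVec, Sum.elim_comp_inl, Sum.elim_comp_inr, Matrix.zero_mulVec,
      add_zero]
    rw [add_add_add_comm, ← Sum.elim_add_add, add_zero]
  have h2 : clC P K *ᵥ Sum.elim x ξ + clD P K *ᵥ d =
      P.C₀ *ᵥ x + P.D₀ *ᵥ d + extE P κ *ᵥ (K.mat *ᵥ Sum.elim (measOut P x d) ξ) := by
    rw [← hy, Matrix.mulVec_add, Matrix.mulVec_add, clC, clD, Matrix.add_mulVec,
      Matrix.add_mulVec, Matrix.fromCols_mulVec]
    simp only [← Matrix.mulVec_mulVec, Sum.elim_comp_inl, Sum.elim_comp_inr, Matrix.zero_mulVec,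
      add_zero]
    rw [add_add_add_comm]
  have h3 : ∀ u, Sum.elim q σ ⬝ᵥ extB P κ *ᵥ u + e ⬝ᵥ extE P κ *ᵥ u =
      Sum.elim (coInput P q e) σ ⬝ᵥ u := by
    intro u
    have hu : u = Sum.elim (u ∘ Sum.inl) (u ∘ Sum.inr) := by ext (i | i) <;> rfl
    rw [hu, extB, extE, Matrix.fromBlocks_mulVec, Matrix.fromCols_mulVec]
    simp only [Sum.elim_comp_inl, Sum.elim_comp_inr, Matrix.zero_mulVec, Matrix.one_mulVec,
      add_zero, zero_add, sumElim_dotProduct_sumElim, coInput, add_dotProduct]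
    rw [dotProduct_comm (P.Bᵀ *ᵥ q), dotProduct_comm (P.Eᵀ *ᵥ e), dotProduct_transpose_mulVec,
      dotProduct_transpose_mulVec]
    ring
  rw [plantForm, dissForm, dissForm, h1, h2, dotProduct_add, dotProduct_add e,
    sumElim_dotProduct_sumElim, dotProduct_zero, ctrlForm, ← h3]
  ring

lemma boundedRealLMI_iff (K : Controller κ k m) (γ : ℝ)
    (𝒳 : Matrix (Idx n ⊕ Blk κ) (Idx n ⊕ Blk κ) ℝ) :
    BoundedRealLMI P K γ 𝒳 ↔ 𝒳.PosDef ∧ ∀ z d e, (z ≠ 0 ∨ d ≠ 0 ∨ e ≠ 0) →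
      dissForm (clA P K) (clB P K) (clC P K) (clD P K) γ (𝒳 *ᵥ z) z d e < 0 := by
  rw [BoundedRealLMI]
  refine and_congr_right fun hX => ?_
  have hs : 𝒳ᵀ = 𝒳 := (posDef_iff_real.1 hX).1
  have h : block3
      ((clA P K)ᵀ * 𝒳 + 𝒳 * clA P K) (𝒳 * clB P K)  (clC P K)ᵀ
      ((clB P K)ᵀ * 𝒳)               (-(γ • 1))     (clD P K)ᵀ
      (clC P K)                      (clD P K)      (-(γ • 1)) =
      He (block3 (𝒳 * clA P K) (𝒳 * clB P K) 0 0 (-((γ / 2) • 1)) 0 (clC P K) (clD P K)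
        (-((γ / 2) • 1))) := by
    rw [← block3_eq_he, Matrix.transpose_mul, Matrix.transpose_mul, hs]
  have hd : ∀ z d e, dissForm (𝒳 * clA P K) (𝒳 * clB P K) (clC P K) (clD P K) γ z z d e =
      dissForm (clA P K) (clB P K) (clC P K) (clD P K) γ (𝒳 *ᵥ z) z d e := by
    intro z d e
    rw [dissForm, dissForm, ← Matrix.mulVec_mulVec, ← Matrix.mulVec_mulVec, ← Matrix.mulVec_add]
    conv_lhs => rw [← hs]
    rw [dotProduct_transpose_mulVec, dotProduct_comm (clA P K *ᵥ z + _)]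
  rw [h, negDef_he_iff]
  constructor
  · intro hN z d e h0
    rw [← hd, ← dotProduct_block3_mulVec]
    exact hN _ (by rwa [sumElim_ne_zero_iff, sumElim_ne_zero_iff])
  · intro hN z hz
    obtain ⟨v, d, e, rfl⟩ := exists_sumElim₃ z
    rw [sumElim_ne_zero_iff, sumElim_ne_zero_iff] at hz
    rw [dotProduct_block3_mulVec, hd]
    exact hN v d e hz

end ClosedLoopForm

/-! ### The inequalities of the construction as conditions on quadratic forms -/

section Step

variable {p : ℕ} {n k m : Fin p → ℕ} {nd ne : ℕ}

/-- The summand `diag(L_j, L_j) S_j diag(R_jᵀ, R_jᵀ)` of the controller matrix. -/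
def Params.term (S : Params n k m) (j : Fin p) :
    Matrix (Idx m ⊕ Blk (KBlk n)) (Idx k ⊕ Blk (KBlk n)) ℝ :=
  Matrix.fromBlocks (selL (fun i => Fin (m i)) j.castSucc) 0 0 (selL (KBlk n) j.castSucc) *
    S j * Matrix.fromBlocks (selR (fun i => Fin (k i)) j)ᵀ 0 0 (selR (KBlk n) j)ᵀ

/-- The part of the controller matrix that stems from the parameters with indices `j ≥ ν`. -/
def Params.tail (S : Params n k m) (ν : Fin (p + 1)) :
    Matrix (Idx m ⊕ Blk (KBlk n)) (Idx k ⊕ Blk (KBlk n)) ℝ :=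
  ∑ j ∈ Finset.univ.filter fun j : Fin p => ν ≤ j.castSucc, S.term j

lemma Params.controller_mat (S : Params n k m) : S.controller.mat = S.tail 0 := by
  simp [Params.controller, Controller.mat, Controller.ofMat, Matrix.fromBlocks_toBlocks,
    Params.tail, Params.term]

variable (P : Plant n k m nd ne)

/-- The inequalities of the controller construction in terms of quadratic forms, with a terminal
one for `ν = p`. -/
def StepNeg (γ : ℝ) (W : DecVars n) (S : Params n k m) (ν : Fin (p + 1)) : Prop :=
  ∀ w d e, (w ≠ 0 ∨ d ≠ 0 ∨ e ≠ 0) →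
    (∀ a : Idx k, a.1.val < ν.val → measOut P (rowY W *ᵥ w) d a = 0) →
    (∀ b : Blk (KBlk n), b.1.val < ν.val → (rowV W *ᵥ w) b = 0) →
    plantForm P γ (rowX W *ᵥ w) (rowY W *ᵥ w) d e +
      ctrlForm P (S.tail ν) (rowX W *ᵥ w) (rowY W *ᵥ w) (rowU n *ᵥ w) (rowV W *ᵥ w) d e < 0

lemma mem_kappaSpace (W : DecVars n) (ν : Fin p) (w : Ext n → ℝ) (d : Fin nd → ℝ)
    (e : Fin ne → ℝ) :
    Sum.elim w (Sum.elim d e) ∈ kappaSpace P W ν ↔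
      (∀ a : Idx k, a.1.val < ν.val → measOut P (rowY W *ᵥ w) d a = 0) ∧
      (∀ b : Blk (KBlk n), b.1.val < ν.val → (rowV W *ᵥ w) b = 0) := by
  rw [kappaSpace, ker, LinearMap.mem_ker, Matrix.mulVecLin_apply, Matrix.fromBlocks_mulVec,
    Sum.elim_comp_inl, Sum.elim_comp_inr, Matrix.fromCols_mulVec,
    Sum.elim_comp_inl, Sum.elim_comp_inr, Matrix.zero_mulVec, Matrix.zero_mulVec, add_zero,
    add_zero, Matrix.mul_assoc, ← Matrix.mulVec_mulVec, ← Matrix.mulVec_mulVec,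
    ← Matrix.mulVec_mulVec, ← Matrix.mulVec_mulVec, ← Matrix.mulVec_add,
    selLc_transpose_mulVec, selLc_transpose_mulVec]
  constructor
  · intro h
    exact ⟨fun a ha => congrFun h (Sum.inl ⟨a, ha⟩), fun b hb => congrFun h (Sum.inr ⟨b, hb⟩)⟩
  · rintro ⟨h1, h2⟩
    ext (i | i)
    · exact h1 i.1 i.2
    · exact h2 i.1 i.2

lemma stepM_transpose_mulVec (W : DecVars n) (j : Fin p) (w : Ext n → ℝ) (d : Fin nd → ℝ)
    (e : Fin ne → ℝ) :
    (stepM P W j)ᵀ *ᵥ Sum.elim w (Sum.elim d e) =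
      Sum.elim (fun b => coInput P (rowX W *ᵥ w) e b.1) (fun b => (rowU n *ᵥ w) b.1) := by
  rw [stepM, Matrix.fromBlocks_transpose, Matrix.transpose_fromRows, Matrix.fromBlocks_mulVec,
    Sum.elim_comp_inl, Sum.elim_comp_inr, Matrix.fromCols_mulVec, Sum.elim_comp_inl,
    Sum.elim_comp_inr]
  simp only [Matrix.transpose_mul, Matrix.transpose_transpose, Matrix.transpose_zero,
    Matrix.zero_mulVec, zero_add, add_zero, ← Matrix.mulVec_mulVec,
    selL_transpose_mulVec]
  rfl

lemma stepN_mulVec (W : DecVars n) (j : Fin p) (w : Ext n → ℝ) (d : Fin nd → ℝ)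
    (e : Fin ne → ℝ) :
    stepN P W j *ᵥ Sum.elim w (Sum.elim d e) =
      Sum.elim (fun i => measOut P (rowY W *ᵥ w) d ⟨j, i⟩) (fun i => (rowV W *ᵥ w) ⟨j, i⟩) := by
  rw [stepN, Matrix.fromBlocks_mulVec, Sum.elim_comp_inl, Sum.elim_comp_inr,
    Matrix.fromCols_mulVec, Sum.elim_comp_inl, Sum.elim_comp_inr]
  simp only [Matrix.mul_assoc, Matrix.zero_mulVec, add_zero, ← Matrix.mulVec_mulVec,
    selR_transpose_mulVec]
  rfl

lemma ctrlForm_term (W : DecVars n) (S : Params n k m) (j : Fin p) (w : Ext n → ℝ)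
    (d : Fin nd → ℝ) (e : Fin ne → ℝ) :
    Sum.elim w (Sum.elim d e) ⬝ᵥ (stepM P W j * S j * stepN P W j) *ᵥ Sum.elim w (Sum.elim d e) =
      ctrlForm P (S.term j) (rowX W *ᵥ w) (rowY W *ᵥ w) (rowU n *ᵥ w) (rowV W *ᵥ w) d e := by
  rw [← Matrix.transpose_transpose (stepM P W j), Matrix.mul_assoc, ← Matrix.mulVec_mulVec,
    dotProduct_transpose_mulVec, stepM_transpose_mulVec, ← Matrix.mulVec_mulVec, stepN_mulVec,
    ctrlForm, Params.term,
    ← Matrix.transpose_transpose (Matrix.fromBlocks (selL (fun i => Fin (m i)) j.castSucc) _ _ _),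
    Matrix.mul_assoc, ← Matrix.mulVec_mulVec, dotProduct_transpose_mulVec,
    Matrix.fromBlocks_transpose, Matrix.fromBlocks_mulVec, ← Matrix.mulVec_mulVec,
    Matrix.fromBlocks_mulVec]
  simp only [Sum.elim_comp_inl, Sum.elim_comp_inr, Matrix.transpose_zero, Matrix.zero_mulVec,
    zero_add, add_zero, selL_transpose_mulVec, selR_transpose_mulVec]

lemma ctrlForm_sum {ι : Type} (s : Finset ι)
    (M : ι → Matrix (Idx m ⊕ Blk (KBlk n)) (Idx k ⊕ Blk (KBlk n)) ℝ) (q x : Idx n → ℝ)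
    (σ ξ : Blk (KBlk n) → ℝ) (d : Fin nd → ℝ) (e : Fin ne → ℝ) :
    ctrlForm P (∑ j ∈ s, M j) q x σ ξ d e = ∑ j ∈ s, ctrlForm P (M j) q x σ ξ d e := by
  simp only [ctrlForm, Matrix.sum_mulVec, dotProduct_sum]

/-- The matrix of the `ν`-th inequality of the controller construction, before projection. -/
def stepMat (γ : ℝ) (W : DecVars n) (S : Params n k m) (s : Finset (Fin p)) :
    Matrix (Ext n ⊕ (Fin nd ⊕ Fin ne)) (Ext n ⊕ (Fin nd ⊕ Fin ne)) ℝ :=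
  stepQ P γ W + ∑ j ∈ s, stepM P W j * S j * stepN P W j

lemma dotProduct_stepMat_mulVec (γ : ℝ) (W : DecVars n) (S : Params n k m) (s : Finset (Fin p))
    (w : Ext n → ℝ) (d : Fin nd → ℝ) (e : Fin ne → ℝ) :
    Sum.elim w (Sum.elim d e) ⬝ᵥ stepMat P γ W S s *ᵥ Sum.elim w (Sum.elim d e) =
      plantForm P γ (rowX W *ᵥ w) (rowY W *ᵥ w) d e +
        ctrlForm P (∑ j ∈ s, S.term j) (rowX W *ᵥ w) (rowY W *ᵥ w) (rowU n *ᵥ w)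
          (rowV W *ᵥ w) d e := by
  rw [stepMat, Matrix.add_mulVec, dotProduct_add, stepQ, dotProduct_block3_mulVec, dissForm_congr,
    Matrix.sum_mulVec, dotProduct_sum, ctrlForm_sum]
  simp only [ctrlForm_term]

lemma stepLMI_eq (γ : ℝ) (W : DecVars n) {h : Fin p → ℕ}
    (Kb : ∀ ν, Matrix (Ext n ⊕ (Fin nd ⊕ Fin ne)) (Fin (h ν)) ℝ) (S : Params n k m) (ν : Fin p) :
    StepLMI P γ W Kb S ν ↔
      NegDef (He ((Kb ν)ᵀ * stepMat P γ W S (Finset.Ici ν) * Kb ν)) := by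
  rw [StepLMI, stepMat, Matrix.mul_add, Matrix.add_mul, Matrix.mul_sum, Matrix.sum_mul]

lemma stepLMI_iff (γ : ℝ) (W : DecVars n) {h : Fin p → ℕ}
    {Kb : ∀ ν, Matrix (Ext n ⊕ (Fin nd ⊕ Fin ne)) (Fin (h ν)) ℝ} (S : Params n k m) (ν : Fin p)
    (hK : IsBasisMatrix (Kb ν) (kappaSpace P W ν)) :
    StepLMI P γ W Kb S ν ↔ StepNeg P γ W S ν.castSucc := by
  have hI : Finset.Ici ν = Finset.univ.filter fun j : Fin p => ν.castSucc ≤ j.castSucc := by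
    ext j
    simp
  rw [stepLMI_eq, hK.negDef_he_iff, hI]
  constructor
  · intro H w d e h0 h1 h2
    have := H _ ((mem_kappaSpace P W ν w d e).2 ⟨h1, h2⟩)
      (by rwa [sumElim_ne_zero_iff, sumElim_ne_zero_iff])
    rwa [dotProduct_stepMat_mulVec] at this
  · intro H z hz hz0
    obtain ⟨w, d, e, rfl⟩ := exists_sumElim₃ z
    rw [mem_kappaSpace] at hz
    rw [sumElim_ne_zero_iff, sumElim_ne_zero_iff] at hz0
    rw [dotProduct_stepMat_mulVec]
    exact H w d e hz0 hz.1 hz.2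

end Step

/-! ### The bounded real lemma -/

section BoundedReal

variable {a b c : Type} [Fintype a] [DecidableEq a] [Fintype b] [DecidableEq b] [Fintype c]

/-- The vector of real parts. -/
def reVec {a : Type} (x : a → ℂ) : a → ℝ := fun i => (x i).re

/-- The vector of imaginary parts. -/
def imVec {a : Type} (x : a → ℂ) : a → ℝ := fun i => (x i).im

lemma reVec_map_mulVec {a b : Type} [Fintype b] (A : Matrix a b ℝ) (x : b → ℂ) :
    reVec (A.map (algebraMap ℝ ℂ) *ᵥ x) = A *ᵥ reVec x := by
  ext i
  simp [reVec, Matrix.mulVec, dotProduct]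

lemma imVec_map_mulVec {a b : Type} [Fintype b] (A : Matrix a b ℝ) (x : b → ℂ) :
    imVec (A.map (algebraMap ℝ ℂ) *ᵥ x) = A *ᵥ imVec x := by
  ext i
  simp [imVec, Matrix.mulVec, dotProduct]

lemma reVec_add {a : Type} (x y : a → ℂ) : reVec (x + y) = reVec x + reVec y := rfl

lemma imVec_add {a : Type} (x y : a → ℂ) : imVec (x + y) = imVec x + imVec y := rfl

lemma reVec_smul {a : Type} (s : ℂ) (x : a → ℂ) :
    reVec (s • x) = s.re • reVec x - s.im • imVec x := by
  ext i
  simp [reVec, imVec]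

lemma imVec_smul {a : Type} (s : ℂ) (x : a → ℂ) :
    imVec (s • x) = s.re • imVec x + s.im • reVec x := by
  ext i
  simp [reVec, imVec]

lemma reVec_ne_zero_or {a : Type} {x : a → ℂ} (hx : x ≠ 0) : reVec x ≠ 0 ∨ imVec x ≠ 0 := by
  by_contra! h
  refine hx (funext fun i => Complex.ext (congrFun h.1 i) (congrFun h.2 i))

/-- This is the real part of `x* X (s x)`, written with real vectors so that real inequalities apply
to real and imaginary parts separately. The terms with `s.im` cancel by symmetry. -/
lemma lyapunov_identity {a : Type} [Fintype a] {X : Matrix a a ℝ} (hX : X.IsSymm)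
    (s : ℂ) (x : a → ℂ) :
    (X *ᵥ reVec x) ⬝ᵥ reVec (s • x) + (X *ᵥ imVec x) ⬝ᵥ imVec (s • x) =
      s.re * (reVec x ⬝ᵥ X *ᵥ reVec x + imVec x ⬝ᵥ X *ᵥ imVec x) := by
  rw [reVec_smul, imVec_smul]
  simp only [dotProduct_add, dotProduct_sub, dotProduct_smul, smul_eq_mul]
  rw [dotProduct_comm (X *ᵥ reVec x), dotProduct_comm (X *ᵥ reVec x),
    dotProduct_comm (X *ᵥ imVec x), dotProduct_comm (X *ᵥ imVec x),
    IsSymm.dotProduct_mulVec_comm hX (imVec x) (reVec x)]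
  ring

/-- For an eigenvector, `lyapunov_identity` equates a negative number with `μ.re` times a
nonnegative one. -/
lemma hurwitz_of_lyapunov {A X : Matrix a a ℝ} (hX : X.PosDef)
    (h : ∀ z, z ≠ 0 → (X *ᵥ z) ⬝ᵥ A *ᵥ z < 0) : Hurwitz A := by
  intro μ hμ
  rw [spectrum.mem_iff, Matrix.isUnit_iff_isUnit_det, isUnit_iff_ne_zero, not_not] at hμ
  obtain ⟨x, hx0, hx⟩ := Matrix.exists_mulVec_eq_zero_iff.2 hμ
  have hx' : A.map (algebraMap ℝ ℂ) *ᵥ x = μ • x := by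
    rw [Matrix.sub_mulVec, Algebra.algebraMap_eq_smul_one, Matrix.smul_mulVec, Matrix.one_mulVec,
      sub_eq_zero] at hx
    exact hx.symm
  obtain ⟨hs, hpos⟩ := posDef_iff_real.1 hX
  have hnn : ∀ z, 0 ≤ z ⬝ᵥ X *ᵥ z := fun z => by
    by_cases h0 : z = 0
    · simp [h0]
    · exact (hpos z h0).le
  have hnp : ∀ z, (X *ᵥ z) ⬝ᵥ A *ᵥ z ≤ 0 := fun z => by
    by_cases h0 : z = 0
    · simp [h0]
    · exact (h z h0).le
  have key := lyapunov_identity hs μ x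
  rw [← hx', reVec_map_mulVec, imVec_map_mulVec] at key
  have hq : 0 ≤ reVec x ⬝ᵥ X *ᵥ reVec x + imVec x ⬝ᵥ X *ᵥ imVec x :=
    add_nonneg (hnn _) (hnn _)
  have hlt : (X *ᵥ reVec x) ⬝ᵥ A *ᵥ reVec x + (X *ᵥ imVec x) ⬝ᵥ A *ᵥ imVec x < 0 := by
    rcases reVec_ne_zero_or hx0 with h0 | h0
    · linarith [h _ h0, hnp (imVec x)]
    · linarith [h _ h0, hnp (reVec x)]
  by_contra hcon
  rw [not_lt] at hcon
  have := mul_nonneg hcon hq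
  linarith

/-- The `H∞`-norm is a supremum, so a strict bound on it needs some slack. The strict inequality is
an open condition and survives a small decrease of `γ`. -/
lemma exists_smaller_gain {a : Type} [Fintype a] [DecidableEq c] {A X : Matrix a a ℝ}
    {B : Matrix a b ℝ} {C : Matrix c a ℝ} {D : Matrix c b ℝ} {γ : ℝ} (hγ : 0 < γ) (hX : X.IsSymm)
    (h : ∀ z d e, (z ≠ 0 ∨ d ≠ 0 ∨ e ≠ 0) → dissForm A B C D γ (X *ᵥ z) z d e < 0) :
    ∃ γ' : ℝ, 0 < γ' ∧ γ' < γ ∧ ∀ z d e, dissForm A B C D γ' (X *ᵥ z) z d e ≤ 0 := by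
  let f : ℝ → Matrix (a ⊕ (b ⊕ c)) (a ⊕ (b ⊕ c)) ℝ := fun ε =>
    block3 (X * A) (X * B) 0 0 (-(((γ - ε) / 2) • 1)) 0 C D (-(((γ - ε) / 2) • 1))
  have hf : ∀ ε z d e, Sum.elim z (Sum.elim d e) ⬝ᵥ f ε *ᵥ Sum.elim z (Sum.elim d e) =
      dissForm A B C D (γ - ε) (X *ᵥ z) z d e := by
    intro ε z d e
    rw [dotProduct_block3_mulVec, dissForm, dissForm, ← Matrix.mulVec_mulVec,
      ← Matrix.mulVec_mulVec, ← Matrix.mulVec_add, dotProduct_comm (X *ᵥ z),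
      IsSymm.dotProduct_mulVec_comm hX]
  have hc : Continuous f := by
    refine continuous_matrix ?_
    rintro (i | i | i) (j | j | j) <;> simp only [f, block3, Matrix.fromBlocks_apply₁₁,
      Matrix.fromBlocks_apply₁₂, Matrix.fromBlocks_apply₂₁, Matrix.fromBlocks_apply₂₂,
      Matrix.fromCols_apply_inl, Matrix.fromCols_apply_inr, Matrix.fromRows_apply_inl,
      Matrix.fromRows_apply_inr, Matrix.neg_apply, Matrix.smul_apply, smul_eq_mul] <;> fun_prop
  have hev := eventually_neg_on ⊤ f hc.continuousAt (by
    intro z _ hz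
    obtain ⟨v, d, e, rfl⟩ := exists_sumElim₃ z
    rw [hf, sub_zero]
    rw [sumElim_ne_zero_iff, sumElim_ne_zero_iff] at hz
    exact h v d e hz)
  have hev2 : ∀ᶠ ε in nhdsWithin (0 : ℝ) (Set.Ioi 0), 0 < ε ∧ ε < γ := by
    filter_upwards [self_mem_nhdsWithin,
      nhdsWithin_le_nhds (gt_mem_nhds hγ)] with ε h1 h2 using ⟨h1, h2⟩
  obtain ⟨ε, hε, h1, h2⟩ := ((hev.filter_mono nhdsWithin_le_nhds).and hev2).exists
  refine ⟨γ - ε, by linarith, by linarith, fun z d e => ?_⟩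
  rw [← hf]
  by_cases h0 : Sum.elim z (Sum.elim d e) = 0
  · rw [h0]
    simp
  · exact (hε _ trivial h0).le

lemma sum_norm_sq {a : Type} [Fintype a] (x : a → ℂ) :
    ∑ i, ‖x i‖ ^ 2 = reVec x ⬝ᵥ reVec x + imVec x ⬝ᵥ imVec x := by
  simp only [dotProduct, ← Finset.sum_add_distrib, reVec, imVec]
  refine Finset.sum_congr rfl fun i _ => ?_
  rw [← Complex.normSq_eq_norm_sq, Complex.normSq_apply]

/-- A dissipation inequality yields a bound on the transfer matrix in the right half-plane. -/
lemma specNorm_transferAt_le {A X : Matrix a a ℝ} {B : Matrix a b ℝ} {C : Matrix c a ℝ}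
    {D : Matrix c b ℝ} {γ : ℝ} (hγ : 0 < γ) (hX : X.PosDef)
    (h : ∀ z d e, dissForm A B C D γ (X *ᵥ z) z d e ≤ 0) (hA : Hurwitz A) {s : ℂ}
    (hs : 0 < s.re) : specNorm (transferAt A B C D s) ≤ γ := by
  obtain ⟨hsym, hpos⟩ := posDef_iff_real.1 hX
  have hnn : ∀ z, 0 ≤ z ⬝ᵥ X *ᵥ z := fun z => by
    by_cases h0 : z = 0
    · simp [h0]
    · exact (hpos z h0).le
  have hunit : IsUnit (Matrix.scalar a s - A.map (algebraMap ℝ ℂ)) := by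
    by_contra hcon
    have := hA s (by rw [spectrum.mem_iff]; exact hcon)
    linarith
  rw [Matrix.isUnit_iff_isUnit_det] at hunit
  refine ContinuousLinearMap.opNorm_le_bound _ hγ.le fun d => ?_
  let dv : b → ℂ := d.ofLp
  let x : a → ℂ := (Matrix.scalar a s - A.map (algebraMap ℝ ℂ))⁻¹ *ᵥ
    (B.map (algebraMap ℝ ℂ) *ᵥ dv)
  let w : c → ℂ := C.map (algebraMap ℝ ℂ) *ᵥ x + D.map (algebraMap ℝ ℂ) *ᵥ dv
  have hw : (Matrix.toEuclideanLin (transferAt A B C D s) d).ofLp = w := by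
    change transferAt A B C D s *ᵥ dv = w
    rw [transferAt, Matrix.add_mulVec, ← Matrix.mulVec_mulVec, ← Matrix.mulVec_mulVec]
  have hx : s • x = A.map (algebraMap ℝ ℂ) *ᵥ x + B.map (algebraMap ℝ ℂ) *ᵥ dv := by
    have h1 : (Matrix.scalar a s - A.map (algebraMap ℝ ℂ)) *ᵥ x = B.map (algebraMap ℝ ℂ) *ᵥ dv := by
      rw [Matrix.mulVec_mulVec, Matrix.mul_nonsing_inv _ hunit, Matrix.one_mulVec]
    rw [← h1, Matrix.sub_mulVec, add_sub_cancel, Matrix.scalar_apply, ← Matrix.smul_one_eq_diagonal,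
      Matrix.smul_mulVec, Matrix.one_mulVec]
  have key := lyapunov_identity hsym s x
  rw [hx, reVec_add, imVec_add, reVec_map_mulVec, imVec_map_mulVec, reVec_map_mulVec,
    imVec_map_mulVec] at key
  have hwr : C *ᵥ reVec x + D *ᵥ reVec dv = reVec w := by
    rw [reVec_add, reVec_map_mulVec, reVec_map_mulVec]
  have hwi : C *ᵥ imVec x + D *ᵥ imVec dv = imVec w := by
    rw [imVec_add, imVec_map_mulVec, imVec_map_mulVec]
  -- The value `e = γ⁻¹ (C x + D d)` maximises the concave quadratic in `e` and contributes `|C x +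
  -- D d|² / (2γ)`.
  have h1 := h (reVec x) (reVec dv) (γ⁻¹ • reVec w)
  have h2 := h (imVec x) (imVec dv) (γ⁻¹ • imVec w)
  rw [dissForm, hwr] at h1
  rw [dissForm, hwi] at h2
  simp only [smul_dotProduct, dotProduct_smul, smul_eq_mul] at h1 h2
  -- The storage term is nonnegative in the right half-plane and can be dropped.
  have hq : 0 ≤ s.re * (reVec x ⬝ᵥ X *ᵥ reVec x + imVec x ⬝ᵥ X *ᵥ imVec x) :=
    mul_nonneg hs.le (add_nonneg (hnn _) (hnn _))
  have hsq : ∑ i, ‖w i‖ ^ 2 ≤ γ ^ 2 * ∑ i, ‖dv i‖ ^ 2 := by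
    rw [sum_norm_sq, sum_norm_sq]
    set r := reVec w ⬝ᵥ reVec w
    set t := imVec w ⬝ᵥ imVec w
    set r' := reVec dv ⬝ᵥ reVec dv
    set t' := imVec dv ⬝ᵥ imVec dv
    have e1 : ∀ r : ℝ, γ⁻¹ * r - γ / 2 * (γ⁻¹ * (γ⁻¹ * r)) = (2 * γ)⁻¹ * r := by
      intro r
      field_simp
      ring
    have h3 : (2 * γ)⁻¹ * (r + t) ≤ γ / 2 * (r' + t') := by
      have := e1 r
      have := e1 t
      linarith
    have h4 := mul_le_mul_of_nonneg_left h3 (by positivity : 0 ≤ 2 * γ)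
    rw [← mul_assoc, mul_inv_cancel₀ (by positivity), one_mul] at h4
    linarith
  change ‖Matrix.toEuclideanLin (transferAt A B C D s) d‖ ≤ γ * ‖d‖
  rw [EuclideanSpace.norm_eq, EuclideanSpace.norm_eq]
  calc _ = Real.sqrt (∑ i, ‖w i‖ ^ 2) := by rw [← hw]
    _ ≤ Real.sqrt (γ ^ 2 * ∑ i, ‖dv i‖ ^ 2) := Real.sqrt_le_sqrt hsq
    _ = _ := by rw [Real.sqrt_mul (sq_nonneg γ), Real.sqrt_sq hγ.le]

end BoundedReal

/-! ### From the bounded-real LMI to the synthesis problem, and relabeling of controller states -/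

section Controllers

variable {p : ℕ} {n k m : Fin p → ℕ} {nd ne : ℕ} {κ : Fin p → Type}
  [∀ i, Fintype (κ i)] [∀ i, DecidableEq (κ i)] (P : Plant n k m nd ne)

lemma BoundedRealLMI.solvesHinf {K : Controller κ k m} {γ : ℝ} (hγ : 0 < γ)
    {𝒳 : Matrix (Idx n ⊕ Blk κ) (Idx n ⊕ Blk κ) ℝ} (h : BoundedRealLMI P K γ 𝒳) :
    SolvesHinf P K γ := by
  rw [boundedRealLMI_iff] at h
  obtain ⟨hX, h⟩ := h
  have hH : Hurwitz (clA P K) := by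
    refine hurwitz_of_lyapunov hX fun z hz => ?_
    have := h z 0 0 (Or.inl hz)
    simpa [dissForm] using this
  refine ⟨hH, ?_⟩
  obtain ⟨γ', h0, hlt, hγ'⟩ := exists_smaller_gain hγ (posDef_iff_real.1 hX).1 h
  refine lt_of_le_of_lt (iSup₂_le fun s hs => ?_) ((ENNReal.ofReal_lt_ofReal_iff hγ).2 hlt)
  exact ENNReal.ofReal_le_ofReal (specNorm_transferAt_le h0 hX hγ' hH hs)

lemma mcMillanDegree_le {x i o : Type} [Fintype x] [DecidableEq x]
    (A : Matrix x x ℝ) (B : Matrix x i ℝ) (C : Matrix o x ℝ) (D : Matrix o i ℝ) :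
    mcMillanDegree A B C D ≤ Fintype.card x := by
  let e := (Fintype.equivFin x).symm
  refine Nat.sInf_le ⟨A.submatrix e e, B.submatrix e id, C.submatrix id e, D, ?_⟩
  have h : Matrix.scalar (Fin (Fintype.card x)) (RatFunc.X : RatFunc ℝ) -
      (A.submatrix e e).map (algebraMap ℝ (RatFunc ℝ)) =
      (Matrix.scalar x RatFunc.X - A.map (algebraMap ℝ (RatFunc ℝ))).submatrix e e := by
    rw [Matrix.submatrix_sub]
    simp [Matrix.submatrix_map, Matrix.scalar_apply]
  rw [transferFun, transferFun, h, Matrix.inv_submatrix_equiv, ← Matrix.submatrix_map,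
    ← Matrix.submatrix_map, Matrix.submatrix_mul_equiv, Matrix.submatrix_mul_equiv]
  rfl

/-- The controller with relabeled states. -/
def Controller.reindex {κ' : Fin p → Type} (f : ∀ i, κ' i ≃ κ i) (K : Controller κ k m) :
    Controller κ' k m where
  A := K.A.submatrix (Equiv.sigmaCongrRight f) (Equiv.sigmaCongrRight f)
  B := K.B.submatrix (Equiv.sigmaCongrRight f) id
  C := K.C.submatrix id (Equiv.sigmaCongrRight f)
  D := K.D

lemma Controller.IsStructured.reindex {κ κ' : Fin p → Type} (f : ∀ i, κ' i ≃ κ i)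
    {K : Controller κ k m} (hK : K.IsStructured) : (K.reindex f).IsStructured :=
  ⟨fun _ _ h => hK.1 _ _ h, fun _ _ h => hK.2.1 _ _ h, fun _ _ h => hK.2.2.1 _ _ h, hK.2.2.2⟩

/-- The construction indexes each controller block by `Idx n`, whereas the existence statements ask
for `Fin (nK i)`. Relabeling changes neither the plant form nor the controller form. -/
lemma BoundedRealLMI.reindex {κ' : Fin p → Type} [∀ i, Fintype (κ' i)] [∀ i, DecidableEq (κ' i)]
    (f : ∀ i, κ' i ≃ κ i) {K : Controller κ k m} {γ : ℝ}
    {𝒳 : Matrix (Idx n ⊕ Blk κ) (Idx n ⊕ Blk κ) ℝ} (h : BoundedRealLMI P K γ 𝒳) :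
    ∃ 𝒳', BoundedRealLMI P (K.reindex f) γ 𝒳' := by
  let F : Blk κ' ≃ Blk κ := Equiv.sigmaCongrRight f
  let G : Idx n ⊕ Blk κ' ≃ Idx n ⊕ Blk κ := Equiv.sumCongr (Equiv.refl _) F
  rw [boundedRealLMI_iff] at h
  refine ⟨𝒳.submatrix G G, (boundedRealLMI_iff _ _ _ _).2 ⟨h.1.submatrix G.injective, ?_⟩⟩
  intro z d e h0
  obtain ⟨x, ξ, rfl⟩ : ∃ x ξ, z = Sum.elim x (ξ ∘ F) :=
    ⟨z ∘ Sum.inl, z ∘ Sum.inr ∘ F.symm, by ext (i | i) <;> simp⟩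
  have hz : Sum.elim x (ξ ∘ F) = Sum.elim x ξ ∘ G := by ext (i | i) <;> rfl
  have hz0 : Sum.elim x (ξ ∘ F) ≠ 0 → Sum.elim x ξ ≠ 0 := by
    rw [hz]
    intro h1 h2
    exact h1 (by rw [h2]; rfl)
  have key := h.2 (Sum.elim x ξ) d e (h0.imp_left hz0)
  obtain ⟨q, σ, hq⟩ : ∃ q σ, 𝒳 *ᵥ Sum.elim x ξ = Sum.elim q σ :=
    ⟨_, _, (Sum.elim_comp_inl_inr _).symm⟩
  have hq' : 𝒳.submatrix G G *ᵥ Sum.elim x (ξ ∘ F) = Sum.elim q (σ ∘ F) := by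
    rw [hz, Matrix.submatrix_mulVec_equiv, Function.comp_assoc, Equiv.self_comp_symm,
      Function.comp_id, hq]
    ext (i | i) <;> rfl
  rw [hq, closedLoop_form] at key
  rw [hq', closedLoop_form]
  have hm : (K.reindex f).mat = K.mat.submatrix (Equiv.sumCongr (Equiv.refl _) F)
      (Equiv.sumCongr (Equiv.refl _) F) := by
    ext (i | i) (j | j) <;> rfl
  have hc : ctrlForm P (K.reindex f).mat q x (σ ∘ F) (ξ ∘ F) d e =
      ctrlForm P K.mat q x σ ξ d e := by
    have e1 : ∀ {t : Type} (u : t → ℝ) (v : Blk κ → ℝ), Sum.elim u (v ∘ F) =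
        Sum.elim u v ∘ Equiv.sumCongr (Equiv.refl _) F := by
      intro t u v
      ext (i | i) <;> rfl
    rw [ctrlForm, ctrlForm, hm, e1, e1, Matrix.submatrix_mulVec_equiv, Function.comp_assoc,
      Equiv.self_comp_symm, Function.comp_id, comp_equiv_dotProduct_comp_equiv]
  rw [hc]
  exact key

end Controllers

/-! ### Consequences of the coupling inequalities -/

section Coupling

variable {a b : Type} [Fintype a] [Fintype b]

lemma isSymm_of_form {M : Matrix a a ℝ} (h : ∀ x y, x ⬝ᵥ M *ᵥ y = y ⬝ᵥ M *ᵥ x) : M.IsSymm := by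
  refine Matrix.ext_iff_mulVec.2 fun v => dotProduct_eq _ _ fun u => ?_
  rw [dotProduct_comm, dotProduct_transpose_mulVec, dotProduct_comm (M *ᵥ v), h]

/-- Completion of squares: in the coordinates `Y v + Y' w` and `Y' w` the coupling matrix is block
diagonal with blocks `Q` and `Q' - Q`. -/
lemma coupling_form {Q Q' X Y X' Y' : Matrix a a ℝ} (hQ : Q.IsSymm) (hX : X = Q * Y)
    (hX' : X' = Q' * Y') (v w : a → ℝ) :
    Sum.elim v w ⬝ᵥ Matrix.fromBlocks (Yᵀ * X) (Xᵀ * Y') (Y'ᵀ * X) (Y'ᵀ * X') *ᵥ Sum.elim v w =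
      (Y *ᵥ v + Y' *ᵥ w) ⬝ᵥ Q *ᵥ (Y *ᵥ v + Y' *ᵥ w) + (Y' *ᵥ w) ⬝ᵥ (Q' - Q) *ᵥ (Y' *ᵥ w) := by
  rw [Matrix.fromBlocks_mulVec, Sum.elim_comp_inl, Sum.elim_comp_inr, sumElim_dotProduct_sumElim]
  simp only [← Matrix.mulVec_mulVec, dotProduct_add, dotProduct_transpose_mulVec]
  subst hX hX'
  simp only [← Matrix.mulVec_mulVec, Matrix.mulVec_add, Matrix.sub_mulVec, dotProduct_add,
    add_dotProduct, dotProduct_sub]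
  rw [IsSymm.dotProduct_mulVec_comm hQ (Y *ᵥ v) (Y' *ᵥ w),
    dotProduct_comm (Q *ᵥ Y *ᵥ v) (Y *ᵥ v), dotProduct_comm (Q *ᵥ Y *ᵥ v) (Y' *ᵥ w),
    dotProduct_comm (Q' *ᵥ Y' *ᵥ w)]
  ring

/-- `Q (min i j)` is `Q 0` plus the increments up to `min i j`, so the double sum is a sum of
squares of the tails `y l + ⋯ + y p`, weighted by `Q 0` and the increments. The induction splits off
the first square and continues with `Q j.succ - Q 0`. -/
lemma sum_form_min_pos {p : ℕ} (Q : Fin (p + 1) → Matrix a a ℝ) (h0 : (Q 0).PosDef)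
    (hQ : ∀ j : Fin p, (Q j.succ - Q j.castSucc).PosDef) (y : Fin (p + 1) → a → ℝ) (hy : y ≠ 0) :
    0 < ∑ i, ∑ j, y i ⬝ᵥ Q (min i j) *ᵥ y j := by
  induction p with
  | zero =>
    have : y 0 ≠ 0 := fun h => hy (funext fun i => by rw [Fin.fin_one_eq_zero i, h]; rfl)
    simpa using (posDef_iff_real.1 h0).2 _ this
  | succ p ih =>
    have hs : (Q 0).IsSymm := (posDef_iff_real.1 h0).1
    have hnn : ∀ z, 0 ≤ z ⬝ᵥ Q 0 *ᵥ z := fun z => by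
      by_cases h : z = 0
      · simp [h]
      · exact ((posDef_iff_real.1 h0).2 z h).le
    have hmin : ∀ i j : Fin (p + 1), min i.succ j.succ = (min i j).succ := fun i j =>
      ((Fin.strictMono_succ (n := p + 1)).monotone.map_min (a := i) (b := j)).symm
    set t := ∑ j : Fin (p + 1), y j.succ with ht
    have key : ∑ i, ∑ j, y i ⬝ᵥ Q (min i j) *ᵥ y j =
        (y 0 + t) ⬝ᵥ Q 0 *ᵥ (y 0 + t) +
          ∑ i : Fin (p + 1), ∑ j : Fin (p + 1),
            y i.succ ⬝ᵥ (Q (min i j).succ - Q 0) *ᵥ y j.succ := by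
      have e1 : (y 0 + t) ⬝ᵥ Q 0 *ᵥ (y 0 + t) = y 0 ⬝ᵥ Q 0 *ᵥ y 0 + 2 * (y 0 ⬝ᵥ Q 0 *ᵥ t) +
          t ⬝ᵥ Q 0 *ᵥ t := by
        rw [Matrix.mulVec_add, add_dotProduct, dotProduct_add, dotProduct_add,
          IsSymm.dotProduct_mulVec_comm hs t (y 0)]
        ring
      have e2 : ∑ j : Fin (p + 1), y 0 ⬝ᵥ Q 0 *ᵥ y j.succ = y 0 ⬝ᵥ Q 0 *ᵥ t := by
        rw [ht, Matrix.mulVec_sum, dotProduct_sum]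
      have e3 : ∑ i : Fin (p + 1), y i.succ ⬝ᵥ Q 0 *ᵥ y 0 = y 0 ⬝ᵥ Q 0 *ᵥ t := by
        rw [IsSymm.dotProduct_mulVec_comm hs, ht, sum_dotProduct]
      have e4 : ∑ i : Fin (p + 1), ∑ j : Fin (p + 1), y i.succ ⬝ᵥ Q 0 *ᵥ y j.succ =
          t ⬝ᵥ Q 0 *ᵥ t := by
        rw [ht, sum_dotProduct]
        refine Finset.sum_congr rfl fun i _ => ?_
        rw [Matrix.mulVec_sum, dotProduct_sum]
      rw [Fin.sum_univ_succ, Fin.sum_univ_succ]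
      simp only [Fin.sum_univ_succ (n := p + 1) (f := fun j => y (Fin.succ _) ⬝ᵥ _ *ᵥ y j),
        Finset.sum_add_distrib, hmin, min_eq_left (Fin.zero_le _), min_eq_right (Fin.zero_le _),
        Matrix.sub_mulVec, dotProduct_sub, Finset.sum_sub_distrib]
      rw [e1, e2, e3, e4]
      ring
    rw [key]
    by_cases hy' : (fun j : Fin (p + 1) => y j.succ) = 0
    · have h1 : ∀ j : Fin (p + 1), y j.succ = 0 := fun j => congrFun hy' j
      have h2 : y 0 ≠ 0 := fun h => hy (funext fun i => by
        refine Fin.cases h (fun j => h1 j) i)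
      have h3 : t = 0 := by rw [ht]; exact Finset.sum_eq_zero fun j _ => h1 j
      simp only [h1, h3, Matrix.mulVec_zero, dotProduct_zero, Finset.sum_const_zero, add_zero]
      exact (posDef_iff_real.1 h0).2 _ h2
    · have := ih (fun j => Q j.succ - Q 0) (by simpa using hQ 0) (fun j => by
        have := hQ j.succ
        simpa using this) (fun j => y j.succ) hy'
      linarith [hnn (y 0 + t)]

/-- If `Yᵀ Z` is positive definite and `Y`, `Z` are square, then `Z = X Y` with a positive definite
`X`. -/
lemma exists_posDef_factor {Y Z : Matrix a b ℝ} (hc : Fintype.card a = Fintype.card b)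
    (h : (Yᵀ * Z).PosDef) :
    ∃ X : Matrix a a ℝ, X.PosDef ∧ ∀ z, ∃ w, z = Y *ᵥ w ∧ X *ᵥ z = Z *ᵥ w := by
  classical
  have hinj : Function.Injective Y.mulVecLin := by
    rw [← LinearMap.ker_eq_bot, LinearMap.ker_eq_bot']
    intro w hw
    by_contra h0
    have h1 := (posDef_iff_real.1 h).2 w h0
    rw [← Matrix.mulVec_mulVec, dotProduct_transpose_mulVec, ← Matrix.mulVecLin_apply Y, hw,
      dotProduct_zero] at h1
    exact lt_irrefl _ h1
  have hsurj : Function.Surjective Y.mulVecLin :=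
    (LinearMap.injective_iff_surjective_of_finrank_eq_finrank (by simp [hc])).1 hinj
  obtain ⟨g, hg⟩ := LinearMap.exists_rightInverse_of_surjective Y.mulVecLin
    (LinearMap.range_eq_top.2 hsurj)
  let R := LinearMap.toMatrix' g
  have hR : ∀ z, Y *ᵥ (R *ᵥ z) = z := fun z => by
    rw [LinearMap.toMatrix'_mulVec]
    exact LinearMap.congr_fun hg z
  have hYR : Y * R = 1 := Matrix.mulVec_injective (funext fun z => by
    rw [← Matrix.mulVec_mulVec, hR, Matrix.one_mulVec])
  -- The candidate `Z Y⁻¹` is congruent to `Yᵀ Z`, from which it inherits symmetry and positivity.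
  have hX : Z * R = Rᴴ * (Yᵀ * Z) * R := by
    rw [Matrix.conjTranspose_eq_transpose_of_trivial, ← Matrix.mul_assoc Rᵀ,
      ← Matrix.transpose_mul, hYR, Matrix.transpose_one, Matrix.one_mul]
  refine ⟨Z * R, ?_, fun z => ⟨R *ᵥ z, (hR z).symm, (Matrix.mulVec_mulVec _ _ _).symm⟩⟩
  rw [hX]
  exact h.conjTranspose_mul_mul_same (Function.LeftInverse.injective hR)

end Coupling

/-! ### The increasing family `Q_j = X_j Y_j⁻¹` -/

namespace DecVars

variable {p : ℕ} {n : Fin p → ℕ} (W : DecVars n)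

lemma Y_mulVec_lo (j : Fin (p + 1)) (v : Idx n → ℝ) {b : Idx n} (hb : b.1.val < j.val) :
    (W.Y j *ᵥ v) b = v b := by
  have hrow : W.Y j b = (1 : Matrix (Idx n) (Idx n) ℝ) b := by
    ext c
    rw [DecVars.Y, Matrix.reindex_apply, Matrix.submatrix_apply,
      Equiv.sumCompl_symm_apply_of_pos (p := fun a : Idx n => a.1.val < j.val) hb]
    by_cases hc : c.1.val < j.val
    · rw [Equiv.sumCompl_symm_apply_of_pos (p := fun a : Idx n => a.1.val < j.val) hc,
        Matrix.fromBlocks_apply₁₁, Matrix.one_apply, Matrix.one_apply]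
      simp
    · rw [Equiv.sumCompl_symm_apply_of_neg (p := fun a : Idx n => a.1.val < j.val) hc,
        Matrix.fromBlocks_apply₁₂, Matrix.one_apply_ne, Matrix.zero_apply]
      rintro rfl
      exact hc hb
  change W.Y j b ⬝ᵥ v = v b
  rw [hrow]
  exact congrFun (Matrix.one_mulVec v) b

lemma X_mulVec_hi (j : Fin (p + 1)) (v : Idx n → ℝ) {b : Idx n} (hb : ¬ b.1.val < j.val) :
    (W.X j *ᵥ v) b = v b := by
  have hrow : W.X j b = (1 : Matrix (Idx n) (Idx n) ℝ) b := by
    ext c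
    rw [DecVars.X, Matrix.reindex_apply, Matrix.submatrix_apply,
      Equiv.sumCompl_symm_apply_of_neg (p := fun a : Idx n => a.1.val < j.val) hb]
    by_cases hc : c.1.val < j.val
    · rw [Equiv.sumCompl_symm_apply_of_pos (p := fun a : Idx n => a.1.val < j.val) hc,
        Matrix.fromBlocks_apply₂₁, Matrix.one_apply_ne, Matrix.zero_apply]
      rintro rfl
      exact hb hc
    · rw [Equiv.sumCompl_symm_apply_of_neg (p := fun a : Idx n => a.1.val < j.val) hc,
        Matrix.fromBlocks_apply₂₂, Matrix.one_apply, Matrix.one_apply]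
      simp
  change W.X j b ⬝ᵥ v = v b
  rw [hrow]
  exact congrFun (Matrix.one_mulVec v) b

/-- The coupling inequalities. -/
def Coupled : Prop :=
  ∀ j : Fin p, (Matrix.fromBlocks
      ((W.Y j.castSucc)ᵀ * W.X j.castSucc) ((W.X j.castSucc)ᵀ * W.Y j.succ)
      ((W.Y j.succ)ᵀ * W.X j.castSucc)     ((W.Y j.succ)ᵀ * W.X j.succ)).PosDef

/-- The matrix `Q_j = X_j Y_j⁻¹`. -/
def Q (j : Fin (p + 1)) : Matrix (Idx n) (Idx n) ℝ := W.X j * (W.Y j)⁻¹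

variable {W}

lemma Coupled.posDef_YX (hW : W.Coupled) (j : Fin (p + 1)) : ((W.Y j)ᵀ * W.X j).PosDef := by
  cases p with
  | zero =>
    -- For `p = 0` there is no coupling inequality to extract this from, but `Idx n` is empty.
    refine posDef_iff_real.2 ⟨?_, fun x hx => absurd (Subsingleton.elim x 0) hx⟩
    ext i
    exact i.1.elim0
  | succ p =>
    refine Fin.lastCases ?_ (fun i => ?_) j
    · exact (hW (Fin.last p)).submatrix (e := Sum.inr) Sum.inr_injective
    · exact (hW i).submatrix (e := Sum.inl) Sum.inl_injective

lemma Coupled.isUnit_det_Y (hW : W.Coupled) (j : Fin (p + 1)) : IsUnit (W.Y j).det := by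
  have h := (Matrix.isUnit_iff_isUnit_det _).1 (hW.posDef_YX j).isUnit
  rw [Matrix.det_mul, Matrix.det_transpose] at h
  exact isUnit_of_mul_isUnit_left h

lemma Coupled.X_eq (hW : W.Coupled) (j : Fin (p + 1)) : W.X j = W.Q j * W.Y j := by
  rw [Q, Matrix.mul_assoc, Matrix.nonsing_inv_mul _ (hW.isUnit_det_Y j), Matrix.mul_one]

lemma Coupled.Y_mulVec_injective (hW : W.Coupled) (j : Fin (p + 1)) :
    Function.Injective (W.Y j).mulVec :=
  Matrix.mulVec_injective_iff_isUnit.2 ((Matrix.isUnit_iff_isUnit_det _).2 (hW.isUnit_det_Y j))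

lemma Coupled.posDef_Q (hW : W.Coupled) (j : Fin (p + 1)) : (W.Q j).PosDef := by
  have hu := hW.isUnit_det_Y j
  have h : W.Q j = ((W.Y j)⁻¹)ᴴ * ((W.Y j)ᵀ * W.X j) * (W.Y j)⁻¹ := by
    rw [Matrix.conjTranspose_eq_transpose_of_trivial, ← Matrix.mul_assoc, ← Matrix.transpose_mul,
      Matrix.mul_nonsing_inv _ hu, Matrix.transpose_one, Matrix.one_mul, Q]
  rw [h]
  refine (hW.posDef_YX j).conjTranspose_mul_mul_same ?_
  exact Function.LeftInverse.injective (g := (W.Y j).mulVec) fun z => by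
    rw [Matrix.mulVec_mulVec, Matrix.mul_nonsing_inv _ hu, Matrix.one_mulVec]

lemma Coupled.isSymm_Q (hW : W.Coupled) (j : Fin (p + 1)) : (W.Q j).IsSymm :=
  (posDef_iff_real.1 (hW.posDef_Q j)).1

lemma Coupled.posDef_sub (hW : W.Coupled) (j : Fin p) :
    (W.Q j.succ - W.Q j.castSucc).PosDef := by
  refine posDef_iff_real.2 ⟨(hW.isSymm_Q _).sub (hW.isSymm_Q _), fun y hy => ?_⟩
  have hi : ∀ (i : Fin (p + 1)) z, W.Y i *ᵥ ((W.Y i)⁻¹ *ᵥ z) = z := fun i z => by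
    rw [Matrix.mulVec_mulVec, Matrix.mul_nonsing_inv _ (hW.isUnit_det_Y i), Matrix.one_mulVec]
  -- The two vectors satisfy `Y_j v = -y` and `Y_{j+1} w = y`, so that the first square in
  -- `coupling_form` vanishes.
  have hne : Sum.elim ((W.Y j.castSucc)⁻¹ *ᵥ (-y)) ((W.Y j.succ)⁻¹ *ᵥ y) ≠ 0 := by
    rw [sumElim_ne_zero_iff]
    right
    intro h0
    apply hy
    rw [← hi j.succ y, h0, Matrix.mulVec_zero]
  have h := (posDef_iff_real.1 (hW j)).2 _ hne
  rw [coupling_form (hW.isSymm_Q _) (hW.X_eq _) (hW.X_eq _), hi, hi, neg_add_cancel,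
    zero_dotProduct, zero_add] at h
  exact h

end DecVars

/-! ### The extended rows `(Y; V)` and `(X; U)` -/

section Rows

variable {p : ℕ} {n : Fin p → ℕ}

/-- The `j`-th block of a vector with `p + 1` blocks. -/
def blk (w : Ext n → ℝ) (j : Fin (p + 1)) : Idx n → ℝ := fun i => w (j, i)

lemma blk_ne_zero {w : Ext n → ℝ} (hw : w ≠ 0) : ∃ j, blk w j ≠ 0 := by
  by_contra! h
  exact hw (funext fun i => congrFun (h i.1) i.2)

lemma rowX_mulVec (W : DecVars n) (w : Ext n → ℝ) :
    rowX W *ᵥ w = ∑ j, W.X j *ᵥ blk w j := by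
  ext a
  simp [rowX, Matrix.mulVec, dotProduct, Fintype.sum_prod_type, blk]

lemma rowY_mulVec (W : DecVars n) (w : Ext n → ℝ) :
    rowY W *ᵥ w = ∑ j, W.Y j *ᵥ blk w j := by
  ext a
  simp [rowY, Matrix.mulVec, dotProduct, Fintype.sum_prod_type, blk]

lemma rowU_mulVec (w : Ext n → ℝ) (a : Blk (KBlk n)) :
    (rowU n *ᵥ w) a = w (a.1.succ, a.2) := by
  have : rowU n a = Pi.single (a.1.succ, a.2) 1 := by
    ext b
    simp [rowU, Pi.single_apply, Prod.ext_iff]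
  change rowU n a ⬝ᵥ w = _
  rw [this, single_dotProduct, one_mul]

/-- Substituting `X_j = Q_j Y_j` turns the blocks of `V` into `Y_{i+1}ᵀ (Q_j - Q_{i+1}) Y_j`. -/
lemma rowV_mulVec {W : DecVars n} (hW : W.Coupled) (w : Ext n → ℝ) (a : Blk (KBlk n)) :
    (rowV W *ᵥ w) a = ((W.Y a.1.succ)ᵀ *ᵥ ∑ j ∈ Finset.Iic a.1.castSucc,
      (W.Q j - W.Q a.1.succ) *ᵥ (W.Y j *ᵥ blk w j)) a.2 := by
  have h1 : ∀ j, (W.Y a.1.succ)ᵀ *ᵥ ((W.Q j - W.Q a.1.succ) *ᵥ (W.Y j *ᵥ blk w j)) =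
      ((W.Y a.1.succ)ᵀ * W.X j - (W.X a.1.succ)ᵀ * W.Y j) *ᵥ blk w j := by
    intro j
    rw [hW.X_eq j, hW.X_eq a.1.succ, Matrix.transpose_mul, (hW.isSymm_Q _).eq, Matrix.mul_assoc,
      ← Matrix.mul_sub, ← Matrix.sub_mul, ← Matrix.mulVec_mulVec, ← Matrix.mulVec_mulVec]
  rw [Matrix.mulVec_sum]
  simp only [h1]
  have hI : Finset.Iic a.1.castSucc = Finset.univ.filter fun j => j ≤ a.1.castSucc := by
    ext j
    simp
  rw [Finset.sum_apply, hI, Finset.sum_filter]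
  change ∑ b, rowV W a b * w b = _
  rw [Fintype.sum_prod_type]
  refine Finset.sum_congr rfl fun j _ => ?_
  split_ifs with hj
  · refine Finset.sum_congr rfl fun i _ => ?_
    simp [rowV, hj, blk]
  · refine Finset.sum_eq_zero fun i _ => ?_
    simp [rowV, hj]

/-- The matrix `rowV` is block triangular with invertible diagonal blocks. -/
lemma blk_eq_zero_of_rowV {W : DecVars n} (hW : W.Coupled) {w : Ext n → ℝ} {ν : Fin (p + 1)}
    (h : ∀ b : Blk (KBlk n), b.1.val < ν.val → (rowV W *ᵥ w) b = 0) (j : Fin (p + 1))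
    (hj : j < ν) : blk w j = 0 := by
  induction j using WellFoundedLT.induction with
  | ind j ih =>
  obtain ⟨i, rfl⟩ : ∃ i : Fin p, j = i.castSucc :=
    ⟨j.castLT (lt_of_lt_of_le hj (Nat.lt_succ_iff.1 ν.2)), rfl⟩
  -- Forward substitution: the preceding blocks of `w` are zero already, so only the diagonal term
  -- of this block row remains, and its middle factor is definite.
  have hsum : ∑ l ∈ Finset.Iic i.castSucc, (W.Q l - W.Q i.succ) *ᵥ (W.Y l *ᵥ blk w l) =
      (W.Q i.castSucc - W.Q i.succ) *ᵥ (W.Y i.castSucc *ᵥ blk w i.castSucc) := by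
    refine Finset.sum_eq_single _ (fun l hl hne => ?_)
      (fun hn => absurd (Finset.mem_Iic.2 le_rfl) hn)
    have hlt := lt_of_le_of_ne (Finset.mem_Iic.1 hl) hne
    rw [ih l hlt (hlt.trans hj), Matrix.mulVec_zero, Matrix.mulVec_zero]
  have hz : (W.Y i.succ)ᵀ *ᵥ ((W.Q i.castSucc - W.Q i.succ) *ᵥ
      (W.Y i.castSucc *ᵥ blk w i.castSucc)) = 0 := by
    ext l
    have := h ⟨i, l⟩ hj
    rw [rowV_mulVec hW, hsum] at this
    exact this
  have hinj : Function.Injective ((W.Y i.succ)ᵀ).mulVec :=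
    Matrix.mulVec_injective_iff_isUnit.2 ((Matrix.isUnit_iff_isUnit_det _).2
      (by rw [Matrix.det_transpose]; exact hW.isUnit_det_Y _))
  have hz' := hinj (hz.trans (Matrix.mulVec_zero _).symm)
  refine hW.Y_mulVec_injective i.castSucc ?_
  rw [Matrix.mulVec_zero]
  by_contra h0
  have hp := (posDef_iff_real.1 (hW.posDef_sub i)).2 _ h0
  rw [← neg_sub, Matrix.neg_mulVec, hz', neg_zero, dotProduct_zero] at hp
  exact lt_irrefl _ hp

/-- The pairing of `Y` with `X` has the blocks `Y_iᵀ Q_j Y_j`. For `i < j` the pairing of `V` with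
`U` adds `Y_iᵀ (Q_i - Q_j) Y_j`: `V` is the correction that makes the whole symmetric. -/
lemma form_rows {W : DecVars n} (hW : W.Coupled) (w w' : Ext n → ℝ) :
    (rowY W *ᵥ w) ⬝ᵥ (rowX W *ᵥ w') + (rowV W *ᵥ w) ⬝ᵥ (rowU n *ᵥ w') =
      ∑ i, ∑ j, (W.Y i *ᵥ blk w i) ⬝ᵥ W.Q (min i j) *ᵥ (W.Y j *ᵥ blk w' j) := by
  have h1 : (rowY W *ᵥ w) ⬝ᵥ (rowX W *ᵥ w') =
      ∑ j, ∑ i, (W.Y i *ᵥ blk w i) ⬝ᵥ W.Q j *ᵥ (W.Y j *ᵥ blk w' j) := by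
    rw [rowY_mulVec, rowX_mulVec, dotProduct_sum]
    refine Finset.sum_congr rfl fun j _ => ?_
    rw [sum_dotProduct, hW.X_eq j, ← Matrix.mulVec_mulVec]
  have h2 : (rowV W *ᵥ w) ⬝ᵥ (rowU n *ᵥ w') = ∑ j, ∑ i,
      if i < j then (W.Y i *ᵥ blk w i) ⬝ᵥ (W.Q i - W.Q j) *ᵥ (W.Y j *ᵥ blk w' j) else 0 := by
    -- The column `j = 0` is empty on both sides because `U_0 = 0`; block `j` of `U w` is block `j +
    -- 1` of `w`.
    rw [Fin.sum_univ_succ, Finset.sum_eq_zero (s := Finset.univ) (f := fun i : Fin (p + 1) =>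
      if i < 0 then _ else _) (fun i _ => if_neg (Fin.not_lt_zero i)), zero_add]
    rw [dotProduct, Fintype.sum_sigma]
    refine Finset.sum_congr rfl fun j _ => ?_
    have e : ∑ i, (rowV W *ᵥ w) ⟨j, i⟩ * (rowU n *ᵥ w') ⟨j, i⟩ =
        ((W.Y j.succ)ᵀ *ᵥ ∑ i ∈ Finset.Iic j.castSucc,
          (W.Q i - W.Q j.succ) *ᵥ (W.Y i *ᵥ blk w i)) ⬝ᵥ blk w' j.succ := by
      refine Finset.sum_congr rfl fun i _ => ?_
      rw [rowV_mulVec hW, rowU_mulVec]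
      rfl
    have hI : Finset.Iic j.castSucc = Finset.univ.filter fun i => i < j.succ := by
      ext i
      simp [Fin.lt_def, Fin.le_def]
    rw [e, dotProduct_comm, dotProduct_transpose_mulVec, sum_dotProduct, hI, Finset.sum_filter]
    refine Finset.sum_congr rfl fun i _ => ?_
    split_ifs
    · rw [dotProduct_comm, IsSymm.dotProduct_mulVec_comm ((hW.isSymm_Q _).sub (hW.isSymm_Q _))]
    · rfl
  rw [h1, h2, ← Finset.sum_add_distrib, Finset.sum_comm (f := fun i j =>
    (W.Y i *ᵥ blk w i) ⬝ᵥ W.Q (min i j) *ᵥ (W.Y j *ᵥ blk w' j))]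
  refine Finset.sum_congr rfl fun j _ => ?_
  rw [← Finset.sum_add_distrib]
  refine Finset.sum_congr rfl fun i _ => ?_
  split_ifs with hij
  · rw [min_eq_left hij.le, Matrix.sub_mulVec, dotProduct_sub]
    ring
  · rw [min_eq_right (not_lt.1 hij), add_zero]

/-- Through `exists_posDef_factor` this makes `(Y; V) w ↦ (X; U) w` a positive definite certificate
that does not depend on the controller. -/
lemma posDef_rows {W : DecVars n} (hW : W.Coupled) :
    ((Matrix.fromRows (rowY W) (rowV W))ᵀ * Matrix.fromRows (rowX W) (rowU n)).PosDef := by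
  have hf : ∀ w w', w ⬝ᵥ ((Matrix.fromRows (rowY W) (rowV W))ᵀ *
      Matrix.fromRows (rowX W) (rowU n)) *ᵥ w' =
      ∑ i, ∑ j, (W.Y i *ᵥ blk w i) ⬝ᵥ W.Q (min i j) *ᵥ (W.Y j *ᵥ blk w' j) := by
    intro w w'
    rw [← form_rows hW, ← Matrix.mulVec_mulVec, dotProduct_transpose_mulVec,
      Matrix.fromRows_mulVec, Matrix.fromRows_mulVec, sumElim_dotProduct_sumElim,
      dotProduct_comm, dotProduct_comm (rowU n *ᵥ w')]
  refine posDef_iff_real.2 ⟨?_, fun w hw => ?_⟩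
  · refine isSymm_of_form fun w w' => ?_
    rw [hf, hf, Finset.sum_comm]
    refine Finset.sum_congr rfl fun i _ => Finset.sum_congr rfl fun j _ => ?_
    rw [min_comm, IsSymm.dotProduct_mulVec_comm (hW.isSymm_Q _)]
  · rw [hf]
    refine sum_form_min_pos W.Q (hW.posDef_Q 0) hW.posDef_sub (fun i => W.Y i *ᵥ blk w i) ?_
    intro h0
    obtain ⟨j, hj⟩ := blk_ne_zero hw
    refine hj (hW.Y_mulVec_injective j ?_)
    rw [Matrix.mulVec_zero]
    exact congrFun h0 j

end Rows

/-! ### The recursive construction of the controller -/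

section Construction

variable {p : ℕ} {n k m : Fin p → ℕ} {nd ne : ℕ} {P : Plant n k m nd ne} {γ : ℝ} {W : DecVars n}

/-- `Y_j` preserves the blocks before `j`, and by triangularity of `C` the outputs before block `j`
see only those. With the dual `coInput_X` this is why the kernels behind `Γ_j` need not involve the
decision variables. -/
lemma measOut_Y (hC : LowerTri P.C) (W : DecVars n) (j : Fin (p + 1)) (v : Idx n → ℝ)
    (d : Fin nd → ℝ) {a : Idx k} (ha : a.1.val < j.val) :
    measOut P (W.Y j *ᵥ v) d a = measOut P v d a := by
  simp only [measOut, Pi.add_apply]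
  congr 1
  refine Finset.sum_congr rfl fun b _ => ?_
  by_cases hb : b.1.val < j.val
  · rw [W.Y_mulVec_lo j v hb]
  · change P.C a b * _ = P.C a b * _
    rw [hC a b (Fin.lt_def.2 (by omega)), zero_mul, zero_mul]

lemma coInput_X (hB : LowerTri P.B) (W : DecVars n) (j : Fin (p + 1)) (v : Idx n → ℝ)
    (e : Fin ne → ℝ) {b : Idx m} (hb : ¬ b.1.val < j.val) :
    coInput P (W.X j *ᵥ v) e b = coInput P v e b := by
  simp only [coInput, Pi.add_apply]
  congr 1
  refine Finset.sum_congr rfl fun c _ => ?_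
  by_cases hc : c.1.val < j.val
  · change P.B c b * _ = P.B c b * _
    rw [hB c b (Fin.lt_def.2 (by omega)), zero_mul, zero_mul]
  · rw [W.X_mulVec_hi j v hc]

lemma rowX_mulVec_of_single (W : DecVars n) {w : Ext n → ℝ} {ν : Fin (p + 1)}
    (h : ∀ j, j ≠ ν → blk w j = 0) : rowX W *ᵥ w = W.X ν *ᵥ blk w ν := by
  rw [rowX_mulVec]
  exact Finset.sum_eq_single ν (fun j _ hj => by rw [h j hj, Matrix.mulVec_zero])
    (fun hn => absurd (Finset.mem_univ _) hn)

lemma rowY_mulVec_of_single (W : DecVars n) {w : Ext n → ℝ} {ν : Fin (p + 1)}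
    (h : ∀ j, j ≠ ν → blk w j = 0) : rowY W *ᵥ w = W.Y ν *ᵥ blk w ν := by
  rw [rowY_mulVec]
  exact Finset.sum_eq_single ν (fun j _ hj => by rw [h j hj, Matrix.mulVec_zero])
    (fun hn => absurd (Finset.mem_univ _) hn)

/-- The projected inequality bounds the supply form for vectors supported on a single block. -/
lemma plantForm_neg_of_single (hP : P.IsStructured) {ν : Fin (p + 1)}
    (hν : ProjNeg P γ (W.X ν) (W.Y ν) ν) {w : Ext n → ℝ} {d : Fin nd → ℝ} {e : Fin ne → ℝ}
    (h0 : w ≠ 0 ∨ d ≠ 0 ∨ e ≠ 0) (hw : ∀ j, j ≠ ν → blk w j = 0)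
    (h1 : ∀ a : Idx k, a.1.val < ν.val → measOut P (rowY W *ᵥ w) d a = 0)
    (h2 : ∀ b : Idx m, ¬ b.1.val < ν.val → coInput P (rowX W *ᵥ w) e b = 0) :
    plantForm P γ (rowX W *ᵥ w) (rowY W *ᵥ w) d e < 0 := by
  rw [rowX_mulVec_of_single W hw] at h2 ⊢
  rw [rowY_mulVec_of_single W hw] at h1 ⊢
  refine hν (blk w ν) d e (h0.imp_left fun h => ?_) (fun a ha => ?_) (fun b hb => ?_)
  · obtain ⟨j, hj⟩ := blk_ne_zero h
    by_cases hjν : j = ν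
    · rwa [← hjν]
    · exact absurd (hw j hjν) hj
  · rw [← measOut_Y hP.2.2 W ν _ d ha]
    exact h1 a ha
  · rw [← coInput_X hP.2.1 W ν _ e hb]
    exact h2 b hb

/-- The recursion starts for free: `V w = 0` leaves only the last block of `w`, no parameter is
involved, and the projected inequality for `j = p` applies. -/
lemma stepNeg_last (hP : P.IsStructured) (hW : W.Coupled)
    (h : ProjNeg P γ (W.X (Fin.last p)) (W.Y (Fin.last p)) (Fin.last p)) (S : Params n k m) :
    StepNeg P γ W S (Fin.last p) := by
  intro w d e h0 h1 h2
  have hw : ∀ j, j ≠ Fin.last p → blk w j = 0 := fun j hj =>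
    blk_eq_zero_of_rowV hW h2 j (Fin.lt_last_iff_ne_last.2 hj)
  have ht : S.tail (Fin.last p) = 0 := by
    rw [Params.tail, Finset.filter_false_of_mem, Finset.sum_empty]
    intro j _ hj
    exact absurd hj (not_le.2 (Fin.castSucc_lt_last j))
  rw [ht, ctrlForm, Matrix.zero_mulVec, dotProduct_zero, add_zero]
  refine plantForm_neg_of_single hP h h0 hw h1 fun b hb => absurd b.1.2 hb

/-- The projection lemma in the coordinates of `Kb ν`. On the kernel of the right factor the signals
of block `ν` vanish as well, which is the situation of `ν + 1`. On the kernel of the left factor the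
parameters chosen before drop out and the projected inequality for `ν` applies, so earlier choices
cannot obstruct the step. -/
lemma exists_stepLMI (hP : P.IsStructured) (hW : W.Coupled)
    (hproj : ∀ j, ProjNeg P γ (W.X j) (W.Y j) j) {h : Fin p → ℕ}
    {Kb : ∀ ν, Matrix (Ext n ⊕ (Fin nd ⊕ Fin ne)) (Fin (h ν)) ℝ} {ν : Fin p}
    (hK : IsBasisMatrix (Kb ν) (kappaSpace P W ν)) {S : Params n k m}
    (hS : StepNeg P γ W S ν.succ) : ∃ T, StepLMI P γ W Kb (Function.update S ν T) ν := by
  have hinj : Function.Injective (Kb ν).mulVec := Matrix.mulVec_injective_iff.2 hK.1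
  have hsplit : ∀ T, stepMat P γ W (Function.update S ν T) (Finset.Ici ν) =
      stepMat P γ W S (Finset.Ioi ν) + stepM P W ν * T * stepN P W ν := by
    intro T
    have hI : Finset.Ici ν = insert ν (Finset.Ioi ν) := by
      ext j
      simp [le_iff_eq_or_lt]
    rw [stepMat, stepMat, hI, Finset.sum_insert (by simp), Function.update_self,
      Finset.sum_congr rfl (fun j hj => by
        rw [Function.update_of_ne (Finset.mem_Ioi.1 hj).ne'])]
    abel
  have hI : (Finset.univ.filter fun j : Fin p => ν.succ ≤ j.castSucc) = Finset.Ioi ν := by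
    ext j
    simp [Fin.succ_le_castSucc_iff]
  have hmem : ∀ x, x ≠ 0 → ∃ w d e, Kb ν *ᵥ x = Sum.elim w (Sum.elim d e) ∧
      (w ≠ 0 ∨ d ≠ 0 ∨ e ≠ 0) ∧
      (∀ a : Idx k, a.1.val < ν.val → measOut P (rowY W *ᵥ w) d a = 0) ∧
      (∀ b : Blk (KBlk n), b.1.val < ν.val → (rowV W *ᵥ w) b = 0) := by
    intro x hx
    obtain ⟨w, d, e, hwde⟩ := exists_sumElim₃ (Kb ν *ᵥ x)
    refine ⟨w, d, e, hwde, ?_, ?_⟩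
    · rw [← sumElim_ne_zero_iff, ← sumElim_ne_zero_iff, ← hwde]
      intro h0
      exact hx (hinj (h0.trans (Matrix.mulVec_zero _).symm))
    · rw [← mem_kappaSpace P W ν w d e, ← hwde, ← hK.2]
      exact ⟨x, rfl⟩
  obtain ⟨T, hT⟩ := projection_lemma ((Kb ν)ᵀ * stepMat P γ W S (Finset.Ioi ν) * Kb ν)
    ((Kb ν)ᵀ * stepM P W ν) (stepN P W ν * Kb ν) (by
      intro x hx hN
      obtain ⟨w, d, e, hwde, h0, h1, h2⟩ := hmem x hx
      rw [← Matrix.mulVec_mulVec, hwde, stepN_mulVec] at hN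
      rw [dotProduct_congr_mulVec, hwde, dotProduct_stepMat_mulVec, ← hI]
      refine hS w d e h0 (fun a ha => ?_) (fun b hb => ?_)
      · rcases Nat.lt_succ_iff_lt_or_eq.1 ha with ha | ha
        · exact h1 a ha
        · obtain ⟨i, a⟩ := a
          obtain rfl : i = ν := Fin.ext ha
          exact congrFun hN (Sum.inl a)
      · rcases Nat.lt_succ_iff_lt_or_eq.1 hb with hb | hb
        · exact h2 b hb
        · obtain ⟨i, b⟩ := b
          obtain rfl : i = ν := Fin.ext hb
          exact congrFun hN (Sum.inr b)) (by
      intro x hx hM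
      obtain ⟨w, d, e, hwde, h0, h1, h2⟩ := hmem x hx
      rw [Matrix.transpose_mul, Matrix.transpose_transpose, ← Matrix.mulVec_mulVec, hwde,
        stepM_transpose_mulVec] at hM
      have hM1 : ∀ b : Idx m, ¬ b.1.val < ν.val → coInput P (rowX W *ᵥ w) e b = 0 :=
        fun b hb => congrFun hM (Sum.inl ⟨b, hb⟩)
      have hM2 : ∀ b : Blk (KBlk n), ¬ b.1.val < ν.val → (rowU n *ᵥ w) b = 0 :=
        fun b hb => congrFun hM (Sum.inr ⟨b, hb⟩)
      rw [dotProduct_congr_mulVec, hwde, dotProduct_stepMat_mulVec, ctrlForm_sum,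
        Finset.sum_eq_zero, add_zero]
      · refine plantForm_neg_of_single (ν := ν.castSucc) hP (hproj _) h0 (fun j hj => ?_) h1 hM1
        -- The vanishing blocks of `V w` remove the blocks of `w` before `ν`, those of `U w` the
        -- blocks after `ν`. By the shift in `U`, its blocks from `ν` on are the blocks of `w` from
        -- `ν + 1` on.
        rcases lt_or_gt_of_ne hj with hj | hj
        · exact blk_eq_zero_of_rowV hW (ν := ν.castSucc) h2 j hj
        · obtain ⟨i, rfl⟩ := Fin.exists_succ_eq.2 (Fin.ne_zero_of_lt hj)
          ext l
          have := hM2 ⟨i, l⟩ (by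
            rw [Fin.lt_def] at hj
            simp at hj
            change ¬ i.val < ν.val
            omega)
          rwa [rowU_mulVec] at this
      · intro j hj
        -- `L_j` with `j > ν` selects co-signals that lie among those from block `ν` on, which are
        -- zero.
        have hj := Fin.lt_def.1 (Finset.mem_Ioi.1 hj)
        rw [← ctrlForm_term, ← Matrix.transpose_transpose (stepM P W j), Matrix.mul_assoc,
          ← Matrix.mulVec_mulVec, dotProduct_transpose_mulVec, stepM_transpose_mulVec,
          show (fun b : Hi (fun i => Fin (m i)) j.castSucc => coInput P (rowX W *ᵥ w) e b.1) = 0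
            from funext fun b => hM1 b.1 fun hb => b.2 (hb.trans hj),
          show (fun b : Hi (KBlk n) j.castSucc => (rowU n *ᵥ w) b.1) = 0
            from funext fun b => hM2 b.1 fun hb => b.2 (hb.trans hj)]
        rw [Sum.elim_zero_zero, dotProduct_zero])
  refine ⟨T, ?_⟩
  rw [stepLMI_eq, negDef_he_iff, hsplit, Matrix.mul_add, Matrix.add_mul]
  intro x hx
  have := hT x hx
  simpa only [Matrix.mul_assoc] using this

lemma exists_stepNeg (hP : P.IsStructured) (hW : W.Coupled)
    (hproj : ∀ j, ProjNeg P γ (W.X j) (W.Y j) j) (ν : Fin (p + 1)) :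
    ∃ S : Params n k m, StepNeg P γ W S ν := by
  induction ν using Fin.reverseInduction with
  | last => exact ⟨0, stepNeg_last hP hW (hproj _) 0⟩
  | cast ν ih =>
    obtain ⟨S, hS⟩ := ih
    choose g Kb hKb using fun ν => exists_isBasisMatrix (kappaSpace P W ν)
    obtain ⟨T, hT⟩ := exists_stepLMI hP hW hproj (hKb ν) hS
    exact ⟨_, (stepLMI_iff P γ W _ ν (hKb ν)).1 hT⟩

/-- For `ν = 0` the side conditions are void, and every closed-loop state has the form `(Y; V) w`
with costate `(X; U) w`. -/
lemma StepNeg.boundedRealLMI (hW : W.Coupled) {S : Params n k m} (hS : StepNeg P γ W S 0) :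
    ∃ 𝒳, BoundedRealLMI P S.controller γ 𝒳 := by
  obtain ⟨𝒳, hX, hw⟩ := exists_posDef_factor (by simp; ring) (posDef_rows hW)
  refine ⟨𝒳, (boundedRealLMI_iff _ _ _ _).2 ⟨hX, fun z d e h0 => ?_⟩⟩
  obtain ⟨w, hz, hXz⟩ := hw z
  rw [hXz, hz, Matrix.fromRows_mulVec, Matrix.fromRows_mulVec, closedLoop_form,
    Params.controller_mat]
  refine hS w d e (h0.imp_left ?_) (fun a ha => absurd ha (Nat.not_lt_zero _))
    (fun a ha => absurd ha (Nat.not_lt_zero _))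
  rintro hz0 rfl
  exact hz0 (by rw [hz, Matrix.mulVec_zero])

/-- `R_jᵀ` admits only the columns of block `j`, and `L_j` only the rows from block `j` on. -/
lemma Params.term_apply_eq_zero (S : Params n k m) (j : Fin p) (a : Idx m ⊕ Blk (KBlk n))
    (b : Idx k ⊕ Blk (KBlk n)) (hab : Sum.elim Sigma.fst Sigma.fst a <
      (Sum.elim Sigma.fst Sigma.fst b : Fin p)) : S.term j a b = 0 := by
  rw [Params.term, Matrix.mul_apply]
  refine Finset.sum_eq_zero fun c _ => ?_
  by_cases hb : (Sum.elim Sigma.fst Sigma.fst b : Fin p) = j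
  · rw [Matrix.mul_apply, Finset.sum_eq_zero, zero_mul]
    intro l _
    have hl : Matrix.fromBlocks (selL (fun i => Fin (m i)) j.castSucc) 0 0
        (selL (KBlk n) j.castSucc) a l = 0 := by
      rcases a with a | a <;> rcases l with l | l <;> try rfl
      all_goals
        refine Matrix.one_apply_ne ?_
        rintro rfl
        refine l.2 (Fin.lt_def.1 ?_)
        rw [hb] at hab
        exact hab
    rw [hl, zero_mul]
  · have hc : Matrix.fromBlocks (selR (fun i => Fin (k i)) j)ᵀ 0 0 (selR (KBlk n) j)ᵀ c b = 0 := by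
      rcases b with b | b <;> rcases c with c | c <;> try rfl
      all_goals
        refine Matrix.one_apply_ne ?_
        rintro rfl
        exact hb rfl
    rw [hc, mul_zero]

lemma Params.controller_isStructured (S : Params n k m) : S.controller.IsStructured := by
  have h : ∀ a b, Sum.elim Sigma.fst Sigma.fst a < (Sum.elim Sigma.fst Sigma.fst b : Fin p) →
      S.controller.mat a b = 0 := by
    intro a b hab
    rw [S.controller_mat, Params.tail, Matrix.sum_apply]
    exact Finset.sum_eq_zero fun j _ => S.term_apply_eq_zero j a b hab
  exact ⟨fun a b hab => h (Sum.inr a) (Sum.inr b) hab, fun a b hab => h (Sum.inr a) (Sum.inl b) hab,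
    fun a b hab => h (Sum.inl a) (Sum.inr b) hab, fun a b hab => h (Sum.inl a) (Sum.inl b) hab⟩

lemma Params.controller_degree_le (S : Params n k m) : S.controller.degree ≤ (∑ i, n i) * p := by
  refine (mcMillanDegree_le _ _ _ _).trans (le_of_eq ?_)
  simp [mul_comm]

end Construction

/-! ### Necessity of the synthesis inequalities -/

section Schur

variable {a b : Type} [Fintype a] [Fintype b]

/-- `Q` is the Schur complement of `X` with respect to the coordinates in `s`. -/
def IsSchur (X : Matrix (a ⊕ b) (a ⊕ b) ℝ) (s : b → Prop) (Q : Matrix a a ℝ) : Prop :=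
  ∀ x, ∃ ξ σ, X *ᵥ Sum.elim x ξ = Sum.elim (Q *ᵥ x) σ ∧ (∀ i, ¬ s i → ξ i = 0) ∧
    ∀ i, s i → σ i = 0

/-- Subtracting from `(x, 0)` its `X`-orthogonal projection onto the vectors supported on `s`
minimises the form of `X` over the free coordinates, and the gradient vanishes there. The sign in
`-X` fits `exists_orthogonal_projection`, which treats negative forms. -/
lemma exists_isSchur {X : Matrix (a ⊕ b) (a ⊕ b) ℝ} (hX : X.PosDef) (s : b → Prop) :
    ∃ Q, IsSchur X s Q := by
  classical
  obtain ⟨hs, hpos⟩ := posDef_iff_real.1 hX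
  have hform : ∀ u v, Matrix.toLinearMap₂' ℝ (-X) u v = -(u ⬝ᵥ X *ᵥ v) := fun u v => by
    rw [Matrix.toLinearMap₂'_apply', Matrix.neg_mulVec, dotProduct_neg]
  let U : Submodule ℝ (a ⊕ b → ℝ) :=
    { carrier := {z | (∀ i, z (Sum.inl i) = 0) ∧ ∀ i, ¬ s i → z (Sum.inr i) = 0}
      add_mem' := fun {y z} hy hz => ⟨fun i => by simp [hy.1 i, hz.1 i],
        fun i hi => by simp [hy.2 i hi, hz.2 i hi]⟩
      zero_mem' := ⟨fun _ => rfl, fun _ _ => rfl⟩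
      smul_mem' := fun r z hz => ⟨fun i => by simp [hz.1 i], fun i hi => by simp [hz.2 i hi]⟩ }
  obtain ⟨π, hm, hi, ho⟩ := exists_orthogonal_projection (Matrix.toLinearMap₂' ℝ (-X))
    (fun u v => by rw [hform, hform, IsSymm.dotProduct_mulVec_comm hs]) U
    (fun u _ h0 => by rw [hform]; linarith [hpos u h0])
  let ι : (a → ℝ) →ₗ[ℝ] (a ⊕ b → ℝ) := (Matrix.fromRows 1 0).mulVecLin
  have hι : ∀ x, ι x = Sum.elim x 0 := fun x => by
    simp [ι, Matrix.fromRows_mulVec]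
  let z : (a → ℝ) →ₗ[ℝ] (a ⊕ b → ℝ) := (LinearMap.id - π) ∘ₗ ι
  have hz : ∀ x, z x = Sum.elim x 0 - π (Sum.elim x 0) := fun x => by
    rw [← hι]
    rfl
  let Q : Matrix a a ℝ := LinearMap.toMatrix'
    (((Matrix.fromCols 1 0 : Matrix a (a ⊕ b) ℝ) * X).mulVecLin ∘ₗ z)
  have hQ : ∀ x, Q *ᵥ x = (X *ᵥ z x) ∘ Sum.inl := fun x => by
    rw [LinearMap.toMatrix'_mulVec, LinearMap.comp_apply, Matrix.mulVecLin_apply,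
      ← Matrix.mulVec_mulVec, Matrix.fromCols_mulVec, Matrix.one_mulVec, Matrix.zero_mulVec,
      add_zero]
  refine ⟨Q, fun x => ⟨z x ∘ Sum.inr, (X *ᵥ z x) ∘ Sum.inr, ?_, fun i h => ?_, fun i h => ?_⟩⟩
  · have h1 : Sum.elim x (z x ∘ Sum.inr) = z x := by
      ext (i | i)
      · rw [hz, Pi.sub_apply, (hm _).1 i, sub_zero]
        rfl
      · rfl
    rw [h1, hQ, Sum.elim_comp_inl_inr]
  · rw [Function.comp_apply, hz, Pi.sub_apply, (hm _).2 i h, sub_zero]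
    rfl
  · have hu : Pi.single (Sum.inr i) 1 ∈ U := by
      refine ⟨fun l => by simp, fun l hl => ?_⟩
      refine Pi.single_eq_of_ne ?_ _
      rintro h'
      obtain rfl := Sum.inr_injective h'
      exact hl h
    have h0 : π (z x) = 0 := by rw [hz, map_sub, hi _ (hm _), sub_self]
    have := ho _ hu _ h0
    rw [hform, single_dotProduct, one_mul, neg_eq_zero] at this
    exact this

lemma IsSchur.form {X : Matrix (a ⊕ b) (a ⊕ b) ℝ} {s : b → Prop} {Q : Matrix a a ℝ}
    {x y : a → ℝ} {ξ η τ : b → ℝ}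
    (hX : X *ᵥ Sum.elim y η = Sum.elim (Q *ᵥ y) τ) (hξ : ∀ i, ¬ s i → ξ i = 0)
    (hτ : ∀ i, s i → τ i = 0) :
    Sum.elim x ξ ⬝ᵥ X *ᵥ Sum.elim y η = x ⬝ᵥ Q *ᵥ y := by
  rw [hX, sumElim_dotProduct_sumElim, add_eq_left]
  refine Finset.sum_eq_zero fun i _ => ?_
  by_cases hi : s i
  · rw [hτ i hi, mul_zero]
  · rw [hξ i hi, zero_mul]

lemma IsSchur.posDef {X : Matrix (a ⊕ b) (a ⊕ b) ℝ} (hX : X.PosDef) {s : b → Prop}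
    {Q : Matrix a a ℝ} (hQ : IsSchur X s Q) : Q.PosDef := by
  obtain ⟨hs, hpos⟩ := posDef_iff_real.1 hX
  refine posDef_iff_real.2 ⟨isSymm_of_form fun x y => ?_, fun x hx => ?_⟩
  · obtain ⟨ξ, σ, h1, h2, h3⟩ := hQ x
    obtain ⟨η, τ, h1', h2', h3'⟩ := hQ y
    rw [← IsSchur.form h1' h2 h3', ← IsSchur.form h1 h2' h3,
      IsSymm.dotProduct_mulVec_comm hs]
  · obtain ⟨ξ, σ, h1, h2, h3⟩ := hQ x
    rw [← IsSchur.form h1 h2 h3]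
    exact hpos _ (sumElim_ne_zero_iff.2 (Or.inl hx))

/-- Eliminating more coordinates decreases the Schur complement. -/
lemma IsSchur.mono {X : Matrix (a ⊕ b) (a ⊕ b) ℝ} (hX : X.PosDef) {s s' : b → Prop}
    (hss : ∀ i, s' i → s i) {Q Q' : Matrix a a ℝ} (hQ : IsSchur X s Q) (hQ' : IsSchur X s' Q')
    (x : a → ℝ) : x ⬝ᵥ Q *ᵥ x ≤ x ⬝ᵥ Q' *ᵥ x := by
  obtain ⟨hs, hpos⟩ := posDef_iff_real.1 hX
  obtain ⟨ξ, σ, h1, h2, h3⟩ := hQ x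
  obtain ⟨η, τ, h1', h2', h3'⟩ := hQ' x
  have hη : ∀ i, ¬ s i → η i = 0 := fun i hi => h2' i fun h => hi (hss i h)
  have e1 := IsSchur.form (x := x) h1 h2 h3
  have e2 := IsSchur.form (x := x) h1 hη h3
  have e3 := IsSchur.form (x := x) h1' h2' h3'
  -- The minimiser `η` is admissible in the larger problem, so the cross term in this square equals
  -- `x ⬝ᵥ Q *ᵥ x`.
  have hnn : 0 ≤ (Sum.elim x η - Sum.elim x ξ) ⬝ᵥ X *ᵥ (Sum.elim x η - Sum.elim x ξ) := by
    by_cases h0 : Sum.elim x η - Sum.elim x ξ = 0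
    · simp [h0]
    · exact (hpos _ h0).le
  rw [Matrix.mulVec_sub, sub_dotProduct, dotProduct_sub, dotProduct_sub,
    IsSymm.dotProduct_mulVec_comm hs (Sum.elim x ξ) (Sum.elim x η), e1, e2, e3] at hnn
  linarith

end Schur

/-! ### Decision variables with `X_j = Q_j Y_j` for given `Q_j` -/

section FromQ

variable {p : ℕ} {n : Fin p → ℕ}

/-- The upper left block of `M` for the partition at the `j`-th block. -/
abbrev blkLL (M : Matrix (Idx n) (Idx n) ℝ) (j : Fin (p + 1)) :
    Matrix (Lo (fun i => Fin (n i)) j) (Lo (fun i => Fin (n i)) j) ℝ :=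
  M.submatrix Subtype.val Subtype.val

/-- The upper right block of `M` for the partition at the `j`-th block. -/
abbrev blkLH (M : Matrix (Idx n) (Idx n) ℝ) (j : Fin (p + 1)) :
    Matrix (Lo (fun i => Fin (n i)) j) (Hi (fun i => Fin (n i)) j) ℝ :=
  M.submatrix Subtype.val Subtype.val

/-- The lower left block of `M` for the partition at the `j`-th block. -/
abbrev blkHL (M : Matrix (Idx n) (Idx n) ℝ) (j : Fin (p + 1)) :
    Matrix (Hi (fun i => Fin (n i)) j) (Lo (fun i => Fin (n i)) j) ℝ :=
  M.submatrix Subtype.val Subtype.val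

/-- The lower right block of `M` for the partition at the `j`-th block. -/
abbrev blkHH (M : Matrix (Idx n) (Idx n) ℝ) (j : Fin (p + 1)) :
    Matrix (Hi (fun i => Fin (n i)) j) (Hi (fun i => Fin (n i)) j) ℝ :=
  M.submatrix Subtype.val Subtype.val

/-- Families of matrices of the dimensions of the lower right blocks. -/
abbrev HiFamily (n : Fin p → ℕ) : Type :=
  ∀ j : Fin (p + 1), Matrix (Hi (fun i => Fin (n i)) j) (Hi (fun i => Fin (n i)) j) ℝ

/-- The decision variables with `X_j = Q_j Y_j`, where `R_j` is meant to be the inverse of the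
lower right block of `Q_j`. -/
def decVarsOf (Q : Fin (p + 1) → Matrix (Idx n) (Idx n) ℝ) (R : HiFamily n) : DecVars n where
  Xh j := blkLL (Q j) j - blkLH (Q j) j * R j * blkHL (Q j) j
  Yh j := R j
  Zh j := R j * blkHL (Q j) j

/-- The inverses of the lower right blocks. -/
def invHi (Q : Fin (p + 1) → Matrix (Idx n) (Idx n) ℝ) : HiFamily n := fun j => (blkHH (Q j) j)⁻¹

variable {Q : Fin (p + 1) → Matrix (Idx n) (Idx n) ℝ}

lemma isUnit_det_hi (hQ : ∀ j, (Q j).PosDef) (j : Fin (p + 1)) : IsUnit (blkHH (Q j) j).det :=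
  (Matrix.isUnit_iff_isUnit_det _).1 ((hQ j).submatrix Subtype.val_injective).isUnit

lemma decVarsOf_isSymm (hQ : ∀ j, (Q j).PosDef) (j : Fin (p + 1)) :
    ((decVarsOf Q (invHi Q)).Xh j).IsSymm ∧ ((decVarsOf Q (invHi Q)).Yh j).IsSymm := by
  have hs : (Q j)ᵀ = Q j := (posDef_iff_real.1 (hQ j)).1
  have hR : (invHi Q j)ᵀ = invHi Q j := by
    rw [invHi, Matrix.transpose_nonsing_inv, Matrix.transpose_submatrix, hs]
  refine ⟨?_, hR⟩
  simp only [decVarsOf, Matrix.IsSymm, Matrix.transpose_sub, Matrix.transpose_mul,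
    Matrix.transpose_submatrix, hs, hR, Matrix.mul_assoc]

/-- Multiplication by `Y_j` is block column elimination: it clears the lower left block of `Q_j`,
turns the lower right one into `I` and leaves a Schur complement in the upper left corner. -/
lemma decVarsOf_X_eq (hQ : ∀ j, (Q j).PosDef) (j : Fin (p + 1)) :
    (decVarsOf Q (invHi Q)).X j = Q j * (decVarsOf Q (invHi Q)).Y j := by
  have hs : (Q j)ᵀ = Q j := (posDef_iff_real.1 (hQ j)).1
  have hu := isUnit_det_hi hQ j
  have hR : (invHi Q j)ᵀ = invHi Q j := (decVarsOf_isSymm hQ j).2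
  let ε := Equiv.sumCompl fun a : Idx n => a.1.val < j.val
  have hblocks : Q j = Matrix.reindex ε ε (Matrix.fromBlocks
      (blkLL (Q j) j) (blkLH (Q j) j) (blkHL (Q j) j) (blkHH (Q j) j)) := by
    rw [Matrix.reindex_apply, ← Matrix.submatrix_id_id (Q j)]
    conv_lhs => rw [← ε.self_comp_symm, ← Matrix.submatrix_submatrix]
    congr 1
    ext (i | i) (l | l) <;> rfl
  conv_rhs => rw [hblocks]
  rw [DecVars.X, DecVars.Y, Matrix.reindex_apply, Matrix.reindex_apply, Matrix.reindex_apply,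
    Matrix.submatrix_mul_equiv, Matrix.fromBlocks_multiply]
  congr 1
  simp only [decVarsOf, Matrix.transpose_mul, hR, Matrix.transpose_submatrix, hs, Matrix.mul_one,
    Matrix.mul_zero, zero_add, Matrix.mul_neg, ← sub_eq_add_neg, ← Matrix.mul_assoc]
  rw [invHi, Matrix.mul_nonsing_inv _ hu, Matrix.one_mul, sub_self]

/-- `Y_j v` displays the blocks of `v` before `j`, and `X_j v = Q_j Y_j v` displays the others. -/
lemma decVarsOf_Y_injective (hQ : ∀ j, (Q j).PosDef) (j : Fin (p + 1)) {v : Idx n → ℝ}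
    (hv : v ≠ 0) : (decVarsOf Q (invHi Q)).Y j *ᵥ v ≠ 0 := by
  intro h0
  refine hv (funext fun b => ?_)
  by_cases hb : b.1.val < j.val
  · rw [← (decVarsOf Q (invHi Q)).Y_mulVec_lo j v hb, h0]
  · rw [← (decVarsOf Q (invHi Q)).X_mulVec_hi j v hb, decVarsOf_X_eq hQ, ← Matrix.mulVec_mulVec,
      h0, Matrix.mulVec_zero]

lemma decVarsOf_coupled (hQ : ∀ j, (Q j).PosDef)
    (hd : ∀ j : Fin p, (Q j.succ - Q j.castSucc).PosDef) :
    (decVarsOf Q (invHi Q)).Coupled := by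
  intro j
  have hX := decVarsOf_X_eq hQ
  have hs : ∀ j, (Q j).IsSymm := fun j => (posDef_iff_real.1 (hQ j)).1
  refine posDef_iff_real.2 ⟨?_, fun z hz => ?_⟩
  · have hYX : ∀ i, (((decVarsOf Q (invHi Q)).Y i)ᵀ * (decVarsOf Q (invHi Q)).X i).IsSymm := by
      intro i
      rw [hX i, Matrix.IsSymm, Matrix.transpose_mul, Matrix.transpose_mul, (hs i).eq,
        Matrix.transpose_transpose, Matrix.mul_assoc]
    refine Matrix.IsSymm.fromBlocks (hYX _) ?_ (hYX _)
    rw [Matrix.transpose_mul, Matrix.transpose_transpose]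
  · obtain ⟨v, w, rfl⟩ : ∃ v w, z = Sum.elim v w := ⟨_, _, (Sum.elim_comp_inl_inr z).symm⟩
    rw [coupling_form (hs _) (hX _) (hX _)]
    have hnn : ∀ z, 0 ≤ z ⬝ᵥ Q j.castSucc *ᵥ z := fun z => by
      by_cases h : z = 0
      · simp [h]
      · exact ((posDef_iff_real.1 (hQ _)).2 z h).le
    by_cases hw : w = 0
    · have hv : v ≠ 0 := (sumElim_ne_zero_iff.1 hz).resolve_right (not_not.2 hw)
      rw [hw, Matrix.mulVec_zero, add_zero, zero_dotProduct, add_zero]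
      exact (posDef_iff_real.1 (hQ _)).2 _ (decVarsOf_Y_injective hQ _ hv)
    · exact add_pos_of_nonneg_of_pos (hnn _)
        ((posDef_iff_real.1 (hd j)).2 _ (decVarsOf_Y_injective hQ _ hw))

end FromQ

/-! ### From a structured controller to the decision variables -/

section Necessity

variable {p : ℕ} {n k m : Fin p → ℕ} {nd ne : ℕ} {P : Plant n k m nd ne} {γ : ℝ}
  {κ : Fin p → Type} [∀ i, Fintype (κ i)] [∀ i, DecidableEq (κ i)]

/-- The remaining co-signals meet the rows before block `j`, the remaining signals the columns from
block `j` on; that corner of a lower block-triangular matrix is zero. -/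
lemma ctrlForm_eq_zero {κ : Fin p → Type} [∀ i, Fintype (κ i)] {K : Controller κ k m}
    (hK : K.IsStructured) (j : Fin (p + 1)) {q x : Idx n → ℝ} {σ ξ : Blk κ → ℝ}
    {d : Fin nd → ℝ} {e : Fin ne → ℝ}
    (h1 : ∀ a : Idx k, a.1.val < j.val → measOut P x d a = 0)
    (h2 : ∀ b : Idx m, ¬ b.1.val < j.val → coInput P q e b = 0)
    (h3 : ∀ a : Blk κ, a.1.val < j.val → ξ a = 0)
    (h4 : ∀ b : Blk κ, ¬ b.1.val < j.val → σ b = 0) : ctrlForm P K.mat q x σ ξ d e = 0 := by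
  refine Finset.sum_eq_zero fun a _ => ?_
  by_cases ha : (Sum.elim Sigma.fst Sigma.fst a : Fin p).val < j.val
  · refine mul_eq_zero_of_right _ (Finset.sum_eq_zero fun b _ => ?_)
    by_cases hb : (Sum.elim Sigma.fst Sigma.fst b : Fin p).val < j.val
    · refine mul_eq_zero_of_right _ ?_
      rcases b with b | b
      · exact h1 b hb
      · exact h3 b hb
    · refine mul_eq_zero_of_left ?_ _
      have hab : (Sum.elim Sigma.fst Sigma.fst a : Fin p) < Sum.elim Sigma.fst Sigma.fst b :=
        Fin.lt_def.2 (by omega)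
      rcases a with a | a <;> rcases b with b | b
      · exact hK.2.2.2 a b hab
      · exact hK.2.2.1 a b hab
      · exact hK.2.1 a b hab
      · exact hK.1 a b hab
  · refine mul_eq_zero_of_left ?_ _
    rcases a with a | a
    · exact h2 a ha
    · exact h4 a ha

/-- A structured controller with a certificate for the bounded-real inequality yields an
increasing family of matrices that satisfy the projected inequalities. -/
lemma exists_schur_family (K : Controller κ k m) (hK : K.IsStructured)
    {𝒳 : Matrix (Idx n ⊕ Blk κ) (Idx n ⊕ Blk κ) ℝ} (h : BoundedRealLMI P K γ 𝒳) :
    ∃ Q : Fin (p + 1) → Matrix (Idx n) (Idx n) ℝ, (∀ j, (Q j).PosDef) ∧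
      (∀ (j : Fin p) x, x ⬝ᵥ Q j.castSucc *ᵥ x ≤ x ⬝ᵥ Q j.succ *ᵥ x) ∧
      ∀ j x d e, (x ≠ 0 ∨ d ≠ 0 ∨ e ≠ 0) →
        (∀ a : Idx k, a.1.val < j.val → measOut P x d a = 0) →
        (∀ b : Idx m, ¬ b.1.val < j.val → coInput P (Q j *ᵥ x) e b = 0) →
        plantForm P γ (Q j *ᵥ x) x d e < 0 := by
  rw [boundedRealLMI_iff] at h
  obtain ⟨hX, h⟩ := h
  -- Eliminating the controller states from block `j` on gives a `ξ` that vanishes before block `j`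
  -- and a `σ` that vanishes from it on, as `ctrlForm_eq_zero` requires.
  choose Q hQ using fun j : Fin (p + 1) =>
    exists_isSchur hX fun b : Blk κ => ¬ b.1.val < j.val
  refine ⟨Q, fun j => (hQ j).posDef hX, fun j => ?_, fun j x d e h0 h1 h2 => ?_⟩
  · refine IsSchur.mono hX (fun i hi => ?_) (hQ _) (hQ _)
    intro h'
    exact hi (h'.trans (Nat.lt_succ_self _))
  · obtain ⟨ξ, σ, hz, hξ, hσ⟩ := hQ j x
    have := h (Sum.elim x ξ) d e (h0.imp_left fun hx => sumElim_ne_zero_iff.2 (Or.inl hx))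
    rwa [hz, closedLoop_form, ctrlForm_eq_zero hK j h1 h2
      (fun a ha => hξ a (not_not.2 ha)) hσ, add_zero] at this

lemma projNeg_decVarsOf (hP : P.IsStructured) {Q : Fin (p + 1) → Matrix (Idx n) (Idx n) ℝ}
    (hQ : ∀ j, (Q j).PosDef) (j : Fin (p + 1))
    (h : ∀ x d e, (x ≠ 0 ∨ d ≠ 0 ∨ e ≠ 0) →
      (∀ a : Idx k, a.1.val < j.val → measOut P x d a = 0) →
      (∀ b : Idx m, ¬ b.1.val < j.val → coInput P (Q j *ᵥ x) e b = 0) →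
      plantForm P γ (Q j *ᵥ x) x d e < 0) :
    ProjNeg P γ ((decVarsOf Q (invHi Q)).X j) ((decVarsOf Q (invHi Q)).Y j) j := by
  intro v d e h0 h1 h2
  have hX : (decVarsOf Q (invHi Q)).X j *ᵥ v = Q j *ᵥ ((decVarsOf Q (invHi Q)).Y j *ᵥ v) := by
    rw [decVarsOf_X_eq hQ, Matrix.mulVec_mulVec]
  rw [hX]
  refine h _ d e (h0.imp_left fun hv => decVarsOf_Y_injective hQ j hv) (fun a ha => ?_)
    (fun b hb => ?_)
  · rw [measOut_Y hP.2.2 _ j v d ha]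
    exact h1 a ha
  · rw [← hX, coInput_X hP.2.1 _ j v e hb]
    exact h2 b hb

/-- With `R` as an independent variable the dependence is polynomial; the inversion is treated in
`continuousAt_invHi` alone. -/
lemma continuous_decVarsOf_X {T : Type} [TopologicalSpace T]
    {Q : T → Fin (p + 1) → Matrix (Idx n) (Idx n) ℝ} {R : T → HiFamily n} (j : Fin (p + 1))
    (hQ : Continuous fun t => Q t j) (hR : Continuous fun t => R t j) :
    Continuous fun t => (decVarsOf (Q t) (R t)).X j := by
  have hX : Continuous fun t => blkLL (Q t j) j - blkLH (Q t j) j * R t j * blkHL (Q t j) j :=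
    (hQ.matrix_submatrix _ _).sub
      (((hQ.matrix_submatrix _ _).matrix_mul hR).matrix_mul (hQ.matrix_submatrix _ _))
  have hZ : Continuous fun t => (R t j * blkHL (Q t j) j)ᵀ :=
    (hR.matrix_mul (hQ.matrix_submatrix _ _)).matrix_transpose
  exact (hX.matrix_fromBlocks hZ continuous_const continuous_const).matrix_reindex _ _

lemma continuous_decVarsOf_Y {T : Type} [TopologicalSpace T]
    {Q : T → Fin (p + 1) → Matrix (Idx n) (Idx n) ℝ} {R : T → HiFamily n} (j : Fin (p + 1))
    (hQ : Continuous fun t => Q t j) (hR : Continuous fun t => R t j) :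
    Continuous fun t => (decVarsOf (Q t) (R t)).Y j := by
  have hZ : Continuous fun t => -(R t j * blkHL (Q t j) j) :=
    (hR.matrix_mul (hQ.matrix_submatrix _ _)).neg
  exact (continuous_const.matrix_fromBlocks continuous_const hZ hR).matrix_reindex _ _

lemma continuous_projMat {T : Type} [TopologicalSpace T] (P : Plant n k m nd ne) (γ : ℝ)
    {X Y : T → Matrix (Idx n) (Idx n) ℝ} (hX : Continuous X) (hY : Continuous Y) :
    Continuous fun t => projMat P γ (X t) (Y t) := by
  have h₁₁ : Continuous fun t => (X t)ᵀ * P.A * Y t :=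
    (hX.matrix_transpose.matrix_mul continuous_const).matrix_mul hY
  have h₁₂ : Continuous fun t => (X t)ᵀ * P.B₀ := hX.matrix_transpose.matrix_mul continuous_const
  have h₃₁ : Continuous fun t => P.C₀ * Y t := continuous_const.matrix_mul hY
  refine continuous_matrix ?_
  rintro (i | i | i) (l | l | l)
  · exact h₁₁.matrix_elem i l
  · exact h₁₂.matrix_elem i l
  · exact continuous_const
  · exact continuous_const
  · exact continuous_const
  · exact continuous_const
  · exact h₃₁.matrix_elem i l
  · exact continuous_const
  · exact continuous_const

lemma continuousAt_invHi {Q : ℝ → Fin (p + 1) → Matrix (Idx n) (Idx n) ℝ}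
    (hc : Continuous Q) (hQ : ∀ j, (Q 0 j).PosDef) : ContinuousAt (fun ε => invHi (Q ε)) 0 := by
  refine continuousAt_pi.2 fun i => ?_
  have hsub : Continuous fun ε => blkHH (Q ε i) i :=
    ((continuous_apply i).comp hc).matrix_submatrix _ _
  have hinv : ContinuousAt Inv.inv (blkHH (Q 0 i) i) := by
    refine continuousAt_matrix_inv _ ?_
    rw [Ring.inverse_eq_inv']
    exact continuousAt_inv₀ (isUnit_det_hi hQ i).ne_zero
  exact Filter.Tendsto.comp hinv (hsub.tendsto 0)

lemma continuousAt_projMat (P : Plant n k m nd ne) (γ : ℝ)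
    {Q : ℝ → Fin (p + 1) → Matrix (Idx n) (Idx n) ℝ}
    (hc : Continuous Q) (hQ : ∀ j, (Q 0 j).PosDef) (j : Fin (p + 1)) :
    ContinuousAt (fun ε => projMat P γ ((decVarsOf (Q ε) (invHi (Q ε))).X j)
      ((decVarsOf (Q ε) (invHi (Q ε))).Y j)) 0 := by
  have h1 : Continuous fun q : (Fin (p + 1) → Matrix (Idx n) (Idx n) ℝ) × HiFamily n => q.1 j :=
    (continuous_apply j).comp continuous_fst
  have h2 : Continuous fun q : (Fin (p + 1) → Matrix (Idx n) (Idx n) ℝ) × HiFamily n => q.2 j :=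
    (continuous_apply j).comp continuous_snd
  have hF := continuous_projMat P γ
    (continuous_decVarsOf_X (Q := Prod.fst) (R := Prod.snd) j h1 h2)
    (continuous_decVarsOf_Y (Q := Prod.fst) (R := Prod.snd) j h1 h2)
  have hG : ContinuousAt (fun ε => (Q ε, invHi (Q ε))) 0 :=
    hc.continuousAt.prodMk (continuousAt_invHi hc hQ)
  have := ContinuousAt.comp (f := fun ε => (Q ε, invHi (Q ε))) hF.continuousAt hG
  exact this

lemma exists_decVars (hP : P.IsStructured) {K : Controller κ k m} (hK : K.IsStructured)
    {𝒳 : Matrix (Idx n ⊕ Blk κ) (Idx n ⊕ Blk κ) ℝ} (h : BoundedRealLMI P K γ 𝒳) :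
    ∃ W : DecVars n, (∀ j, (W.Xh j).IsSymm ∧ (W.Yh j).IsSymm) ∧
      (∀ j, ProjNeg P γ (W.X j) (W.Y j) j) ∧ W.Coupled := by
  obtain ⟨Q, hQ, hmono, hneg⟩ := exists_schur_family K hK h
  -- The Schur complements increase only weakly. Consecutive shifts differ by `ε I`, which makes the
  -- increments definite, while the strict projected inequalities persist for small `ε`.
  let Qε : ℝ → Fin (p + 1) → Matrix (Idx n) (Idx n) ℝ :=
    fun ε j => Q j + (ε * (j.val + 1)) • (1 : Matrix (Idx n) (Idx n) ℝ)
  have hQ0 : Qε 0 = Q := by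
    ext j
    simp [Qε]
  have hc : Continuous Qε := by
    refine continuous_pi fun j => ?_
    fun_prop
  have hev : ∀ᶠ ε in nhds (0 : ℝ), ∀ j, ProjNeg P γ ((decVarsOf (Qε ε) (invHi (Qε ε))).X j)
      ((decVarsOf (Qε ε) (invHi (Qε ε))).Y j) j := by
    rw [Filter.eventually_all]
    intro j
    have h0 := projNeg_decVarsOf hP hQ j (hneg j)
    rw [projNeg_iff] at h0
    have := eventually_neg_on (gammaSpace P j) (fun ε =>
      projMat P γ ((decVarsOf (Qε ε) (invHi (Qε ε))).X j) ((decVarsOf (Qε ε) (invHi (Qε ε))).Y j))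
      (continuousAt_projMat P γ hc (by rw [hQ0]; exact hQ) j) (by
        simp only [hQ0]
        exact h0)
    filter_upwards [this] with ε hε
    rw [projNeg_iff]
    exact hε
  obtain ⟨ε, hε, hpos⟩ :=
    ((hev.filter_mono nhdsWithin_le_nhds).and (self_mem_nhdsWithin (s := Set.Ioi (0 : ℝ)))).exists
  change 0 < ε at hpos
  have hone : ∀ {r : ℝ}, 0 < r → (r • (1 : Matrix (Idx n) (Idx n) ℝ)).PosDef := fun hr =>
    Matrix.PosDef.one.smul hr
  have hQε : ∀ j, (Qε ε j).PosDef := fun j => (hQ j).add (hone (by positivity))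
  have hd : ∀ j : Fin p, (Qε ε j.succ - Qε ε j.castSucc).PosDef := by
    intro j
    refine posDef_iff_real.2 ⟨((posDef_iff_real.1 (hQε _)).1).sub (posDef_iff_real.1 (hQε _)).1,
      fun x hx => ?_⟩
    have h1 := hmono j x
    have h2 := dotProduct_self_pos hx
    simp only [Qε, Matrix.sub_mulVec, Matrix.add_mulVec, Matrix.smul_mulVec, Matrix.one_mulVec,
      dotProduct_sub, dotProduct_add, dotProduct_smul, smul_eq_mul, Fin.val_succ,
      Fin.val_castSucc, Nat.cast_add, Nat.cast_one]
    nlinarith [mul_pos hpos h2]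
  exact ⟨_, decVarsOf_isSymm hQε, hε, decVarsOf_coupled hQε hd⟩

end Necessity

/-! ### Assembly of the equivalence and the construction -/

section Main

variable {p : ℕ} {n k m : Fin p → ℕ} {nd ne : ℕ} {P : Plant n k m nd ne} {γ : ℝ}

lemma feasible_iff {g : Fin (p + 1) → ℕ}
    {Γ : ∀ j, Matrix (Idx n ⊕ (Fin nd ⊕ Fin ne)) (Fin (g j)) ℝ}
    (hΓ : ∀ j, IsBasisMatrix (Γ j) (gammaSpace P j)) (W : DecVars n) :
    Feasible P γ Γ W ↔ (∀ j, (W.Xh j).IsSymm ∧ (W.Yh j).IsSymm) ∧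
      (∀ j, ProjNeg P γ (W.X j) (W.Y j) j) ∧ W.Coupled :=
  and_congr_right fun _ => and_congr_left fun _ => forall_congr' fun j =>
    negDef_proj_iff P γ (W.X j) (W.Y j) j (hΓ j)

/-- From feasible decision variables one obtains a controller whose states are indexed by `Fin`. -/
lemma exists_controller (hP : P.IsStructured) {W : DecVars n}
    (hproj : ∀ j, ProjNeg P γ (W.X j) (W.Y j) j) (hW : W.Coupled) :
    ∃ (nK : Fin p → ℕ) (K : Controller (fun i => Fin (nK i)) k m),
      K.IsStructured ∧ K.degree ≤ (∑ i, n i) * p ∧ ∃ 𝒳, BoundedRealLMI P K γ 𝒳 := by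
  obtain ⟨S, hS⟩ := exists_stepNeg hP hW hproj 0
  obtain ⟨𝒳, hX⟩ := hS.boundedRealLMI hW
  refine ⟨fun _ => Fintype.card (Idx n),
    S.controller.reindex fun _ => (Fintype.equivFin (Idx n)).symm,
    S.controller_isStructured.reindex _, ?_, hX.reindex P _⟩
  refine (mcMillanDegree_le _ _ _ _).trans (le_of_eq ?_)
  simp [mul_comm]

lemma BoundedRealLMI.isSymm {κ : Fin p → Type} [∀ i, Fintype (κ i)] [∀ i, DecidableEq (κ i)]
    {K : Controller κ k m} {𝒳 : Matrix (Idx n ⊕ Blk κ) (Idx n ⊕ Blk κ) ℝ}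
    (h : BoundedRealLMI P K γ 𝒳) : 𝒳.IsSymm :=
  (posDef_iff_real.1 h.1).1

end Main

end NestedHinf

end

open NestedHinf in
theorem theorem2 {p : ℕ} (n k m : Fin p → ℕ) (nd ne : ℕ)
    (P : Plant n k m nd ne) (hP : P.IsStructured) (γ : ℝ) (hγ : 0 < γ)
    (g : Fin (p + 1) → ℕ) (Γ : ∀ j, Matrix (Idx n ⊕ (Fin nd ⊕ Fin ne)) (Fin (g j)) ℝ)
    (hΓ : ∀ j, IsBasisMatrix (Γ j) (gammaSpace P j)) :
    -- existence of a structured controller is equivalent to feasibility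
    ((∃ (nK : Fin p → ℕ) (K : Controller (fun i => Fin (nK i)) k m),
        K.IsStructured ∧ ∃ 𝒳, 𝒳.IsSymm ∧ BoundedRealLMI P K γ 𝒳) ↔
      ∃ W : DecVars n, Feasible P γ Γ W) ∧
    -- degree bound
    ((∃ W : DecVars n, Feasible P γ Γ W) →
      ∃ (nK : Fin p → ℕ) (K : Controller (fun i => Fin (nK i)) k m),
        K.IsStructured ∧ K.degree ≤ (∑ i, n i) * p ∧ SolvesHinf P K γ) ∧
    -- recursive construction from any feasible point
    (∀ W : DecVars n, Feasible P γ Γ W →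
      ∀ (h : Fin p → ℕ) (Kb : ∀ ν, Matrix (Ext n ⊕ (Fin nd ⊕ Fin ne)) (Fin (h ν)) ℝ),
        (∀ ν, IsBasisMatrix (Kb ν) (kappaSpace P W ν)) →
        (∀ (ν : Fin p) (S : Params n k m), (∀ μ, ν < μ → StepLMI P γ W Kb S μ) →
          ∃ T, StepLMI P γ W Kb (Function.update S ν T) ν) ∧
        (∀ S : Params n k m, (∀ ν, StepLMI P γ W Kb S ν) →
          S.controller.IsStructured ∧ S.controller.degree ≤ (∑ i, n i) * p ∧
          (∃ 𝒳, 𝒳.IsSymm ∧ BoundedRealLMI P S.controller γ 𝒳) ∧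
          SolvesHinf P S.controller γ)) := by
  refine ⟨⟨?_, ?_⟩, ?_, ?_⟩
  · rintro ⟨nK, K, hK, 𝒳, -, hX⟩
    obtain ⟨W, hW⟩ := exists_decVars hP hK hX
    exact ⟨W, (feasible_iff hΓ W).2 hW⟩
  · rintro ⟨W, hW⟩
    obtain ⟨-, hproj, hc⟩ := (feasible_iff hΓ W).1 hW
    obtain ⟨nK, K, hK, -, 𝒳, hX⟩ := exists_controller hP hproj hc
    exact ⟨nK, K, hK, 𝒳, hX.isSymm, hX⟩
  · rintro ⟨W, hW⟩
    obtain ⟨-, hproj, hc⟩ := (feasible_iff hΓ W).1 hW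
    obtain ⟨nK, K, hK, hdeg, 𝒳, hX⟩ := exists_controller hP hproj hc
    exact ⟨nK, K, hK, hdeg, hX.solvesHinf P hγ⟩
  · intro W hW h Kb hKb
    obtain ⟨-, hproj, hc⟩ := (feasible_iff hΓ W).1 hW
    refine ⟨fun ν S hS => ?_, fun S hS => ?_⟩
    · refine exists_stepLMI hP hc hproj (hKb ν) ?_
      -- Only the inequality for `ν + 1` is used. For the last `ν` there is none, and the terminal
      -- condition holds automatically.
      by_cases hν : ν.val + 1 < p
      · have := hS ⟨ν.val + 1, hν⟩ (Fin.lt_def.2 (Nat.lt_succ_self _))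
        exact (stepLMI_iff P γ W S _ (hKb _)).1 this
      · have hlast : ν.succ = Fin.last p := Fin.ext (by simp; omega)
        rw [hlast]
        exact stepNeg_last hP hc (hproj _) S
    · have h0 : StepNeg P γ W S 0 := by
        -- For `p = 0` there are no step inequalities, and the index `0` is the terminal one.
        cases p with
        | zero => exact stepNeg_last hP hc (hproj _) S
        | succ p => exact (stepLMI_iff P γ W S 0 (hKb 0)).1 (hS 0)
      obtain ⟨𝒳, hX⟩ := h0.boundedRealLMI hc
      exact ⟨S.controller_isStructured, S.controller_degree_le, ⟨𝒳, hX.isSymm, hX⟩,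
        hX.solvesHinf P hγ⟩
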